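/- A \emph{real} is an element of Cantor space $2^\omega$, and a \emph{measure} is a Borel probability measure on $2^\omega$; for a finite binary string $\sigma$ let $[\sigma]\subseteq 2^\omega$ be the set of reals extending $\sigma$. A measure $\mu$ is \emph{continuous} if $\mu(\{y\})=0$ for every real $y$, and \emph{dyadic} if every value $\mu([\sigma])$ has the form $m/2^n$ with $m,n\in\mathbb{N}$. Let $$d(\mu,\nu)=\sum_{n\ge 1}2^{-n}\cdot\tfrac12\sum_{|\sigma|=n}\bigl|\mu([\sigma])-\nu([\sigma])\bigr| .$$ A \emph{representation} of $\mu$ is a sequence $p=(p_n)_{n\in\mathbb{N}}$ of codes of measures $\nu_{p_n}$, each a finite convex combination with rational coefficients of point masses at reals of the form $\sigma000\cdots$, with $d(\nu_{p_n},\mu)\le 2^{-n}$ for all $n$. A measure is \emph{recursive in} a real $z$ if it has a representation $p$ that is recursive in $z$, and it is then identified with such a representation. For a measure $\mu$ and an oracle $A$, a \emph{$\mu$-test enumerable in $A$} is a sequence $(U_n)_{n\in\mathbb{N}}$ of sets of strings, uniformly recursively enumerable in $A$, with $\sum_{\sigma\in U_n}\mu([\sigma])\le 2^{-n}$ for all $n$;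 it \emph{covers} $x$ if $x\in\bigcap_n\bigcup_{\sigma\in U_n}[\sigma]$. A real $x$ is \emph{random relative to $z$ for $\mu$} (with representation $p$) if no $\mu$-test enumerable in $p\oplus z$ covers $x$. It is \emph{Martin-L\"of random relative to $z$} if no $\mathcal{L}$-test enumerable in $z$ covers $x$, where $\mathcal{L}$ is Lebesgue measure, $\mathcal{L}([\sigma])=2^{-|\sigma|}$. A (total) \emph{functional recursive in $z$} is a map $\Phi:2^\omega\to2^\omega$ for which there is a $z$-recursive, prefix-monotone map $\varphi$ from strings to strings such that, for every real $y$, the strings $\varphi(y{\restriction}k)$, $k\in\mathbb{N}$, are initial segments of $\Phi(y)$ of unbounded length. Two reals $x,y$ are \emph{truth-table equivalent relative to $z$} if there are total functionals $\Phi,\Psi$ recursive in $z$ with $\Phi(y)=x$ and $\Psi(x)=y$. \textbf{Proposition.} For all reals $x$ and $z$ the following are equivalent. (i) $x$ is random relative to $z$ for some continuous measure $\mu$ recursive in $z$. (ii) $x$ is random relative to $z$ for some continuous dyadic measure $\nu$ recursive in $z$. (iii) There is a functional $\Phi$ recursive in $z$ which is a homeomorphism of $2^\omega$ onto itself preserving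 the lexicographic order, such that $\Phi(x)$ is Martin-L\"of random relative to $z$. (iv) $x$ is truth-table equivalent relative to $z$ to some real that is Martin-L\"of random relative to $z$. -/

import Mathlib

open MeasureTheory
open scoped ENNReal

namespace ContRand

/-- Cantor space; its points are the "reals".  It carries the product topology and the product
(= Borel) σ-algebra. -/
abbrev Cantor : Type := ℕ → Bool

/-- Finite binary strings. -/
abbrev Str : Type := List Bool

/-- The initial segment of `y` of length `n`. -/
def restr (y : Cantor) (n : ℕ) : Str := (List.range n).map y

/-- The basic open cylinder of all reals that extend `σ`. -/
def cyl (σ : Str) : Set Cantor := {y | restr y σ.length = σ}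

/-- The open set generated by a set of strings. -/
def openSet (U : Set Str) : Set Cantor := ⋃ σ ∈ U, cyl σ

/-- A sequence with values in an encodable type, regarded as an oracle. -/
def oracle {α : Type} [Primcodable α] (f : ℕ → α) : ℕ →. ℕ :=
  fun n => Part.some (Encodable.encode (f n))

/-! ### Measures and their representations -/

/-- Lebesgue measure: the infinite product of the uniform distribution on `{0,1}`. -/
noncomputable def lebesgue : Measure Cantor :=
  Measure.infinitePi fun _ : ℕ => (PMF.uniformOfFintype Bool).toMeasure

/-- A continuous measure: one without atoms. -/
def IsContinuous (μ : Measure Cantor) : Prop := ∀ y : Cantor, μ {y} = 0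

/-- A dyadic measure: every cylinder has measure `m / 2 ^ n` for some natural numbers `m`, `n`
(which may depend on the cylinder). -/
def IsDyadic (μ : Measure Cantor) : Prop :=
  ∀ σ : Str, ∃ m n : ℕ, μ (cyl σ) = (m : ℝ≥0∞) / 2 ^ n

/-- The metric `∑_{n ≥ 1} 2^{-n} d_n(μ, ν)` on probability measures, where
`d_n(μ, ν) = (1/2) ∑_{|σ| = n} |μ[σ] - ν[σ]|`.  (As `d_n ≤ 1`, the series converges.) -/
noncomputable def measDist (μ ν : Measure Cantor) : ℝ :=
  ∑' n : ℕ, (1 / 2 : ℝ) ^ (n + 1) *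
    ((1 / 2) * ∑ s : Fin (n + 1) → Bool,
      |μ.real (cyl (List.ofFn s)) - ν.real (cyl (List.ofFn s))|)

/-- A code of a finitely supported rational measure: a list of pairs `(σ, k)`, where `k` is the
weight of the point `σ000…`. Weights are to be divided by their total. -/
abbrev Code : Type := List (Str × ℕ)

/-- The sum of the weights of a code. -/
def Code.total (c : Code) : ℕ := (c.map Prod.snd).sum

/-- The point `σ000…` of Cantor space. -/
def padZero (σ : Str) : Cantor := fun i => σ.getD i false

/-- The measure `∑ (k / N) δ_{σ000…}` given by a code with total weight `N`.  Codes with `N > 0`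
give exactly the measures `∑_{σ ∈ Δ} Q(σ) δ_{σ000…}` with `Δ` finite, `Q ≥ 0` rational,
`∑ Q = 1`. -/
noncomputable def Code.measure (c : Code) : Measure Cantor :=
  (c.map fun e => ((e.2 : ℝ≥0∞) / (Code.total c : ℝ≥0∞)) • Measure.dirac (padZero e.1)).sum

/-- `p` represents the measure `μ`: it is a fast Cauchy sequence of (codes of) finitely supported
rational probability measures that converges to `μ`. -/
def Represents (p : ℕ → Code) (μ : Measure Cantor) : Prop :=
  ∀ n, 0 < Code.total (p n) ∧ measDist (Code.measure (p n)) μ ≤ (1 / 2) ^ n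

/-! ### Randomness -/

/-- The sequence `U` of sets of strings is uniformly recursively enumerable in the oracles `O`:
a function recursive in `O` enumerates, for each `n`, exactly the elements of `U n`
(the value `none` enumerates nothing). -/
def UniformlyREIn (O : Set (ℕ →. ℕ)) (U : ℕ → Set Str) : Prop :=
  ∃ e : ℕ → ℕ → Option Str, ComputableIn₂ O e ∧ ∀ n σ, σ ∈ U n ↔ ∃ s, e n s = some σ

/-- A Martin-Löf test for `μ`, enumerable in the oracles `O`. -/
structure IsTest (O : Set (ℕ →. ℕ)) (μ : Measure Cantor) (U : ℕ → Set Str) : Prop where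
  enumerable : UniformlyREIn O U
  measure_le : ∀ n, ∑' σ : U n, μ (cyl σ) ≤ (2⁻¹ : ℝ≥0∞) ^ n

/-- `x` is covered by no Martin-Löf test for `μ` that is enumerable in the oracles `O`. -/
def PassesTests (O : Set (ℕ →. ℕ)) (μ : Measure Cantor) (x : Cantor) : Prop :=
  ∀ U : ℕ → Set Str, IsTest O μ U → x ∉ ⋂ n, openSet (U n)

/-- `x` is random relative to `z` for the measure `μ` with representation `p`: no `μ`-test
enumerable in `p ⊕ z` covers `x`. -/
def RandomRel (μ : Measure Cantor) (p : ℕ → Code) (z x : Cantor) : Prop :=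
  PassesTests {oracle p, oracle z} μ x

/-- `x` is Martin-Löf random relative to `z`. -/
def MLRandomRel (z x : Cantor) : Prop :=
  PassesTests {oracle z} lebesgue x

/-! ### Functionals -/

/-- The total map `Φ` on Cantor space is a functional recursive in `z`: it is induced by a
prefix-monotone map `φ` of strings that is recursive in `z`, i.e. `Φ y` is the union of the
strings `φ (restr y k)`. -/
def RecursiveFunctional (z : Cantor) (Φ : Cantor → Cantor) : Prop :=
  ∃ φ : Str → Str, ComputableIn {oracle z} φ ∧
    (∀ σ τ : Str, σ <+: τ → φ σ <+: φ τ) ∧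
    ∀ y : Cantor, (∀ k, Φ y ∈ cyl (φ (restr y k))) ∧ ∀ n, ∃ k, n ≤ (φ (restr y k)).length

/-- Order preservation with respect to the lexicographic order of Cantor space. -/
def OrderPreserving (Φ : Cantor → Cantor) : Prop :=
  ∀ a b : Cantor, toLex a < toLex b → toLex (Φ a) < toLex (Φ b)

/-- `x` is truth-table reducible to `y` relative to `z`: a total functional recursive in `z`
maps `y` to `x`. -/
def TTReducibleRel (z x y : Cantor) : Prop :=
  ∃ Φ : Cantor → Cantor, RecursiveFunctional z Φ ∧ Φ y = x

/-- Truth-table equivalence relative to `z`. -/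
def TTEquivRel (z x y : Cantor) : Prop :=
  TTReducibleRel z x y ∧ TTReducibleRel z y x

end ContRand

/-! ### Closure properties of relative computability -/

section RelativeComputability

open Encodable

variable {α β γ δ σ : Type*}
variable [Primcodable α] [Primcodable β] [Primcodable γ] [Primcodable δ] [Primcodable σ]
variable {O : Set (ℕ →. ℕ)}

/-! The implications proved are (i) ⇒ (iii) ⇒ (iv) ⇒ (ii) ⇒ (i), the last of them trivial.
Randomness is carried along functionals by `PassesTests.map`: if the image of μ under a recursive
functional is at most a constant times ν, pulling a ν-test back gives a μ-test once finitely many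
levels are dropped.

(i) ⇒ (iii). A point of Cantor space is a cut in the dyadic rationals of [0, 1]; the cut at a dyadic
falls between its two binary expansions. An order automorphism of the dyadics therefore induces an
order-preserving homeomorphism. A back-and-forth construction (`exists_matching`) builds an
automorphism under which every interval has length more than half the μ-measure of its preimage, so
the image of μ is at most twice Lebesgue measure. The factor 2 leaves room: the requirement becomes
a strict inequality, hence can be confirmed from approximations to μ, and every finite stage can be
extended. Finding a target point for a given source point (`Steep.exists_snd`) needs only this
slack; finding a source point for a given target point (`Steep.exists_fst`) needs that μ has no
atoms.

(iii) ⇒ (iv). By compactness the inverse of a recursive homeomorphism is again a recursive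
functional (`RecursiveFunctional.symm`).

(iv) ⇒ (ii). Let Φ send the random R to x and Ψ send x back to R. As long as Ψ ∘ Φ looks like the
identity on the argument, follow Φ; once it is seen to fail, copy the argument. The new functional
still sends R to x, and its fibres are countable, so the image of Lebesgue measure has no atoms.
That image is dyadic with exactly computable cylinder values, because a fixed number of input bits
decides each output prefix (`measure_imageCode_cyl`). -/

theorem Nat.RecursiveIn.prec_bind {f g h : ℕ →. ℕ} (hf : Nat.RecursiveIn O f)
    (hg : Nat.RecursiveIn O g) (hh : Nat.RecursiveIn O h) :
    Nat.RecursiveIn O fun a => (f a).bind fun n => n.rec (g a)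
      fun y IH => do {let i ← IH; h (Nat.pair a (Nat.pair y i))} :=
  ((Nat.RecursiveIn.prec hg hh).comp
    (Nat.RecursiveIn.pair (Nat.Partrec.some.recursiveIn) hf)).of_eq fun a =>
    Part.ext fun s => by simp [Seq.seq]

theorem RecursiveIn.bind {f : α →. β} {g : α → β →. σ} (hf : RecursiveIn O f)
    (hg : RecursiveIn₂ O g) : RecursiveIn O fun a => (f a).bind (g a) :=
  (Nat.RecursiveIn.comp hg (Nat.RecursiveIn.pair Nat.Partrec.some.recursiveIn hf)).of_eq
    fun n => by
      rcases e : decode (α := α) n with _ | a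
      · simp [Seq.seq]
      · simp only [Seq.seq, Part.map_eq_map, Part.coe_some, Part.bind_some, Part.map_some]
        simp [Part.bind_map, e]
        exact (Part.map_bind (g a) (f a) encode).symm

theorem RecursiveIn.comp {f : β →. σ} {g : α → β} (hf : RecursiveIn O f)
    (hg : ComputableIn O g) : RecursiveIn O fun a => f (g a) :=
  (Nat.RecursiveIn.comp hf hg).of_eq fun n => by
    rcases e : decode (α := α) n with - | a <;> simp

theorem RecursiveIn.map {f : α →. β} {g : α → β → σ} (hf : RecursiveIn O f)
    (hg : ComputableIn₂ O g) : RecursiveIn O fun a => (f a).map (g a) := by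
  simpa [Part.bind_some_eq_map] using RecursiveIn.bind (g := fun a x => Part.some (g a x)) hf hg

theorem RecursiveIn.nat_rec {f : α → ℕ} {g : α →. σ} {h : α → ℕ × σ →. σ}
    (hf : ComputableIn O f) (hg : RecursiveIn O g) (hh : RecursiveIn₂ O h) :
    RecursiveIn O fun a => (f a).rec (g a) fun y IH => IH.bind fun i => h a (y, i) :=
  (Nat.RecursiveIn.prec_bind hf hg hh).of_eq fun n => by
    rcases e : decode (α := α) n with - | a
    · simp
    · simp only [Part.coe_some, Part.bind_some, Part.map_some]
      induction f a <;> simp_all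

theorem RecursiveIn.rfind {p : α → ℕ → Bool} (hp : ComputableIn₂ O p) :
    RecursiveIn O fun a => Nat.rfind fun n => Part.some (p a n) :=
  (Nat.RecursiveIn.rfind <| RecursiveIn.map hp
    -- Minimization looks for the value 0, so `true` is coded by 0.
    (g := fun _ b => cond b 0 1)
    (Primrec.computableIn (f := fun q : (α × ℕ) × Bool => cond q.2 0 1)
      ((Primrec.dom_bool fun b => cond b 0 1).comp Primrec.snd))).of_eq fun n => by
    rcases e : decode (α := α) n with _ | a
    · simp only [Part.coe_none, Part.bind_none]
      refine Part.eq_none_iff.2 fun m hm => ?_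
      have := Nat.rfind_spec hm
      simp [e] at this
    · have : ∀ m, (decide ((bif p a m then 0 else 1) = 0)) = p a m := fun m => by
        cases p a m <;> rfl
      simp [e, this, Part.map_id']

attribute [fun_prop] ComputableIn

namespace ComputableIn

theorem of_eq {f g : α → σ} (hf : ComputableIn O f) (H : ∀ n, f n = g n) : ComputableIn O g :=
  (funext H : f = g) ▸ hf

theorem mono {O' : Set (ℕ →. ℕ)} {f : α → σ} (hf : ComputableIn O f) (h : O ⊆ O') :
    ComputableIn O' f :=
  RecursiveIn.mono h hf

@[fun_prop]
theorem fun_id : ComputableIn O fun a : α => a := ComputableIn.id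

@[fun_prop]
theorem fun_const (s : σ) : ComputableIn O fun _ : α => s := ComputableIn.const s

@[fun_prop]
theorem comp {f : β → σ} {g : α → β} (hf : ComputableIn O f) (hg : ComputableIn O g) :
    ComputableIn O fun a => f (g a) :=
  RecursiveIn.comp (f := fun b => Part.some (f b)) hf hg

@[fun_prop]
theorem prodMk {f : α → β} {g : α → γ} (hf : ComputableIn O f) (hg : ComputableIn O g) :
    ComputableIn O fun a => (f a, g a) :=
  (Nat.RecursiveIn.pair hf hg).of_eq fun n => by cases decode (α := α) n <;> simp [Seq.seq]

theorem comp₂ {f : β → γ → σ} {g : α → β} {h : α → γ} (hf : ComputableIn₂ O f)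
    (hg : ComputableIn O g) (hh : ComputableIn O h) : ComputableIn O fun a => f (g a) (h a) :=
  comp (f := fun p : β × γ => f p.1 p.2) hf (hg.prodMk hh)

@[fun_prop]
theorem prod_fst {f : α → β × γ} (hf : ComputableIn O f) : ComputableIn O fun a => (f a).1 :=
  comp ComputableIn.fst hf

@[fun_prop]
theorem prod_snd {f : α → β × γ} (hf : ComputableIn O f) : ComputableIn O fun a => (f a).2 :=
  comp ComputableIn.snd hf

theorem of_primrec_comp {f : β → σ} {g : α → β} (hf : Primrec f) (hg : ComputableIn O g) :
    ComputableIn O fun a => f (g a) :=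
  comp hf.computableIn hg

theorem of_primrec_comp₂ {f : β → γ → σ} {g : α → β} {h : α → γ} (hf : Primrec₂ f)
    (hg : ComputableIn O g) (hh : ComputableIn O h) : ComputableIn O fun a => f (g a) (h a) :=
  comp₂ hf.computableIn₂ hg hh

theorem nat_rec {f : α → ℕ} {g : α → σ} {h : α → ℕ × σ → σ} (hf : ComputableIn O f)
    (hg : ComputableIn O g) (hh : ComputableIn₂ O h) :
    ComputableIn O fun a =>
      Nat.rec (motive := fun _ => σ) (g a) (fun y IH => h a (y, IH)) (f a) :=
  (RecursiveIn.nat_rec (g := fun a => Part.some (g a)) (h := fun a q => Part.some (h a q))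
    hf hg hh).of_eq fun a => by
      dsimp only
      induction f a <;> simp [*]

/-- Unbounded search is total when every instance has a solution, so it yields a computable choice
function. -/
theorem exists_search {p : α → ℕ → Bool} (hp : ComputableIn₂ O p) (h : ∀ a, ∃ n, p a n = true) :
    ∃ f : α → ℕ, ComputableIn O f ∧ ∀ a, p a (f a) = true := by
  have hd : ∀ a, (Nat.rfind fun n => Part.some (p a n)).Dom := fun a => by
    obtain ⟨n, hn⟩ := h a
    exact Nat.rfind_dom.2 ⟨n, by simpa using hn, fun _ => trivial⟩
  refine ⟨fun a => (Nat.rfind fun n => Part.some (p a n)).get (hd a),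
    RecursiveIn.of_eq_tot (RecursiveIn.rfind hp) fun a => Part.get_mem _, fun a => ?_⟩
  have := Nat.rfind_spec (Part.get_mem (hd a))
  simpa using this

/-! ### Arithmetic, Boolean and list operations -/

@[fun_prop]
theorem nat_add {f g : α → ℕ} (hf : ComputableIn O f) (hg : ComputableIn O g) :
    ComputableIn O fun a => f a + g a := of_primrec_comp₂ Primrec.nat_add hf hg

@[fun_prop]
theorem nat_sub {f g : α → ℕ} (hf : ComputableIn O f) (hg : ComputableIn O g) :
    ComputableIn O fun a => f a - g a := of_primrec_comp₂ Primrec.nat_sub hf hg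

@[fun_prop]
theorem nat_mul {f g : α → ℕ} (hf : ComputableIn O f) (hg : ComputableIn O g) :
    ComputableIn O fun a => f a * g a := of_primrec_comp₂ Primrec.nat_mul hf hg

@[fun_prop]
theorem nat_pow {f g : α → ℕ} (hf : ComputableIn O f) (hg : ComputableIn O g) :
    ComputableIn O fun a => f a ^ g a :=
  of_primrec_comp₂ (Primrec₂.unpaired'.1 Nat.Primrec.pow) hf hg

@[fun_prop]
theorem nat_pair {f g : α → ℕ} (hf : ComputableIn O f) (hg : ComputableIn O g) :
    ComputableIn O fun a => Nat.pair (f a) (g a) :=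
  of_primrec_comp₂ Primrec₂.natPair hf hg

@[fun_prop]
theorem nat_div {f g : α → ℕ} (hf : ComputableIn O f) (hg : ComputableIn O g) :
    ComputableIn O fun a => f a / g a := of_primrec_comp₂ Primrec.nat_div hf hg

@[fun_prop]
theorem nat_mod {f g : α → ℕ} (hf : ComputableIn O f) (hg : ComputableIn O g) :
    ComputableIn O fun a => f a % g a := of_primrec_comp₂ Primrec.nat_mod hf hg

@[fun_prop]
theorem nat_blt {f g : α → ℕ} (hf : ComputableIn O f) (hg : ComputableIn O g) :
    ComputableIn O fun a => Nat.blt (f a) (g a) :=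
  (of_primrec_comp₂ Primrec.nat_lt.decide hf hg).of_eq fun a => by
    rw [Bool.eq_iff_iff, Nat.blt_eq, decide_eq_true_iff]

@[fun_prop]
theorem nat_ble {f g : α → ℕ} (hf : ComputableIn O f) (hg : ComputableIn O g) :
    ComputableIn O fun a => Nat.ble (f a) (g a) :=
  (of_primrec_comp₂ Primrec.nat_le.decide hf hg).of_eq fun a => by
    rw [Bool.eq_iff_iff, Nat.ble_eq, decide_eq_true_iff]

@[fun_prop]
theorem nat_unpair {f : α → ℕ} (hf : ComputableIn O f) : ComputableIn O fun a => (f a).unpair :=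
  of_primrec_comp Primrec.unpair hf

@[fun_prop]
theorem eq [DecidableEq β] {f g : α → β} (hf : ComputableIn O f) (hg : ComputableIn O g) :
    ComputableIn O fun a => decide (f a = g a) :=
  of_primrec_comp₂ Primrec.eq.decide hf hg

@[fun_prop]
theorem and {f g : α → Bool} (hf : ComputableIn O f) (hg : ComputableIn O g) :
    ComputableIn O fun a => f a && g a :=
  of_primrec_comp₂ Primrec.and hf hg

@[fun_prop]
theorem or {f g : α → Bool} (hf : ComputableIn O f) (hg : ComputableIn O g) :
    ComputableIn O fun a => f a || g a :=
  of_primrec_comp₂ Primrec.or hf hg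

@[fun_prop]
theorem not {f : α → Bool} (hf : ComputableIn O f) : ComputableIn O fun a => !f a :=
  of_primrec_comp Primrec.not hf

@[fun_prop]
theorem bool_toNat {f : α → Bool} (hf : ComputableIn O f) : ComputableIn O fun a => (f a).toNat :=
  of_primrec_comp (Primrec.dom_bool _) hf

@[fun_prop]
theorem cond {c : α → Bool} {f g : α → σ} (hc : ComputableIn O c) (hf : ComputableIn O f)
    (hg : ComputableIn O g) : ComputableIn O fun a => bif c a then f a else g a :=
  of_primrec_comp (f := fun p : Bool × σ × σ => bif p.1 then p.2.1 else p.2.2)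
    (Primrec.cond .fst (Primrec.fst.comp .snd) (Primrec.snd.comp .snd)) (hc.prodMk (hf.prodMk hg))

section Option

@[fun_prop]
theorem option_some {f : α → β} (hf : ComputableIn O f) : ComputableIn O fun a => some (f a) :=
  of_primrec_comp Primrec.option_some hf

@[fun_prop]
theorem option_isSome {f : α → Option β} (hf : ComputableIn O f) :
    ComputableIn O fun a => (f a).isSome :=
  of_primrec_comp Primrec.option_isSome hf

@[fun_prop]
theorem option_getD {f : α → Option β} {g : α → β} (hf : ComputableIn O f)
    (hg : ComputableIn O g) : ComputableIn O fun a => (f a).getD (g a) :=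
  of_primrec_comp₂ Primrec.option_getD hf hg

@[fun_prop]
theorem nat_decode {f : α → ℕ} (hf : ComputableIn O f) :
    ComputableIn O fun a => Encodable.decode (α := β) (f a) :=
  of_primrec_comp Primrec.decode hf

end Option

section List

@[fun_prop]
theorem list_cons {f : α → β} {g : α → List β} (hf : ComputableIn O f) (hg : ComputableIn O g) :
    ComputableIn O fun a => f a :: g a :=
  of_primrec_comp₂ Primrec.list_cons hf hg

@[fun_prop]
theorem list_append {f g : α → List β} (hf : ComputableIn O f) (hg : ComputableIn O g) :
    ComputableIn O fun a => f a ++ g a :=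
  of_primrec_comp₂ Primrec.list_append hf hg

@[fun_prop]
theorem list_length {f : α → List β} (hf : ComputableIn O f) :
    ComputableIn O fun a => (f a).length :=
  of_primrec_comp Primrec.list_length hf

@[fun_prop]
theorem list_range {f : α → ℕ} (hf : ComputableIn O f) :
    ComputableIn O fun a => List.range (f a) :=
  of_primrec_comp Primrec.list_range hf

@[fun_prop]
theorem list_take {f : α → ℕ} {g : α → List β} (hf : ComputableIn O f) (hg : ComputableIn O g) :
    ComputableIn O fun a => (g a).take (f a) :=
  of_primrec_comp₂ Primrec.list_take hf hg

@[fun_prop]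
theorem list_drop {f : α → ℕ} {g : α → List β} (hf : ComputableIn O f) (hg : ComputableIn O g) :
    ComputableIn O fun a => (g a).drop (f a) :=
  of_primrec_comp₂ Primrec.list_drop hf hg

@[fun_prop]
theorem list_getD {f : α → List β} {g : α → ℕ} (d : β) (hf : ComputableIn O f)
    (hg : ComputableIn O g) : ComputableIn O fun a => (f a).getD (g a) d :=
  of_primrec_comp₂ (f := fun l n => List.getD l n d) (Primrec.list_getD d) hf hg

theorem list_foldl {f : α → List β} {g : α → σ} {h : α → σ → β → σ} (hf : ComputableIn O f)
    (hg : ComputableIn O g) (hh : ComputableIn O fun p : α × σ × β => h p.1 p.2.1 p.2.2) :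
    ComputableIn O fun a => (f a).foldl (h a) (g a) := by
  -- Reading entries by `getD` needs a default element; over an empty type the only list is `[]`.
  rcases isEmpty_or_nonempty β with hβ | ⟨⟨d⟩⟩
  · refine hg.of_eq fun a => ?_
    have : f a = [] := List.eq_nil_of_subset_nil fun b _ => (hβ.false b).elim
    rw [this, List.foldl_nil]
  · refine (nat_rec (f := fun a => (f a).length) (g := g)
      (h := fun a p => h a p.2 ((f a).getD p.1 d)) (by fun_prop) hg ?_).of_eq fun a => ?_
    · exact comp (f := fun p : α × σ × β => h p.1 p.2.1 p.2.2)
        (g := fun p : α × ℕ × σ => (p.1, p.2.2, (f p.1).getD p.2.1 d)) hh (by fun_prop)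
    · have : ∀ k ≤ (f a).length, Nat.rec (motive := fun _ => σ) (g a)
          (fun y IH => h a IH ((f a).getD y d)) k = ((f a).take k).foldl (h a) (g a) := by
        intro k
        induction k with
        | zero => simp
        | succ k ih =>
          intro hk
          have hk' : k < (f a).length := hk
          simp only [ih hk'.le, List.take_add_one, List.foldl_append]
          simp [List.getElem?_eq_getElem hk']
      simpa using this _ le_rfl

@[fun_prop]
theorem list_map {f : α → List β} {g : α → β → σ} (hf : ComputableIn O f)
    (hg : ComputableIn O fun p : α × β => g p.1 p.2) :
    ComputableIn O fun a => (f a).map (g a) := by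
  refine (list_foldl (f := f) (g := fun _ => []) (h := fun a l b => l ++ [g a b]) hf
    (by fun_prop) ?_).of_eq fun a => ?_
  · exact list_append (by fun_prop) (list_cons (comp (g := fun p : α × List σ × β => (p.1, p.2.2))
      hg (by fun_prop)) (by fun_prop))
  · have : ∀ (l : List β) (r : List σ),
        l.foldl (fun l b => l ++ [g a b]) r = r ++ l.map (g a) := by
      intro l
      induction l with
      | nil => simp
      | cons b l ih => intro r; simp [ih]
    simpa using this (f a) []

@[fun_prop]
theorem list_all {f : α → List β} {g : α → β → Bool} (hf : ComputableIn O f)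
    (hg : ComputableIn O fun p : α × β => g p.1 p.2) :
    ComputableIn O fun a => (f a).all (g a) := by
  refine (list_foldl (f := f) (g := fun _ => true) (h := fun a l b => l && g a b) hf
    (by fun_prop) ?_).of_eq fun a => ?_
  · exact and (by fun_prop) (comp (g := fun p : α × Bool × β => (p.1, p.2.2)) hg (by fun_prop))
  · have : ∀ (l : List β) (r : Bool),
        l.foldl (fun l b => l && g a b) r = (r && l.all (g a)) := by
      intro l
      induction l with
      | nil => simp
      | cons b l ih => intro r; simp [ih, Bool.and_assoc]
    simpa using this (f a) true

@[fun_prop]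
theorem list_sum {f : α → List ℕ} (hf : ComputableIn O f) :
    ComputableIn O fun a => (f a).sum := by
  refine (list_foldl (f := f) (g := fun _ => 0) (h := fun _ n b => n + b) hf
    (by fun_prop) (by fun_prop)).of_eq fun a => ?_
  rw [List.sum_eq_foldl]

end List

/-- Computable dependent choice: a sequence whose members are found one after the other by a
search that is guaranteed to succeed as long as an invariant holds. -/
theorem exists_seq {check : List β → β → Bool} (hc : ComputableIn₂ O check)
    (inv : List β → Prop) (h0 : inv []) (hs : ∀ l, inv l → ∃ b, check l b = true)
    (hi : ∀ l b, inv l → check l b = true → inv (l ++ [b])) :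
    ∃ s : ℕ → β, ComputableIn O s ∧
      ∀ k, inv ((List.range k).map s) ∧ check ((List.range k).map s) (s k) = true := by
  obtain ⟨d, -⟩ := hs [] h0
  let p : List β → ℕ → Bool := fun l n =>
    (Encodable.decode (α := β) n).isSome && check l ((Encodable.decode (α := β) n).getD d)
  have hp : ComputableIn₂ O p := by
    have hc' : ComputableIn O fun q : List β × ℕ => check q.1 ((Encodable.decode (α := β) q.2).getD d) :=
      comp₂ hc (by fun_prop) (by fun_prop)
    unfold p
    exact and (by fun_prop) hc'
  have hex : ∀ l, inv l → ∃ n, p l n = true := fun l hl => by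
    obtain ⟨b, hb⟩ := hs l hl
    exact ⟨encode b, by simp [p, hb]⟩
  -- The history is built as a partial function: totality is known only along histories satisfying
  -- the invariant, and `inv` need not be decidable.
  let L : ℕ → Part (List β) := fun k => Nat.rec (Part.some [])
    (fun _ IH => IH.bind fun l => (Nat.rfind fun n => Part.some (p l n)).map
      fun n => l ++ [(Encodable.decode (α := β) n).getD d]) k
  have hL : RecursiveIn O L := by
    refine RecursiveIn.nat_rec (f := fun k => k) (g := fun _ => Part.some [])
      (h := fun _ q => (Nat.rfind fun n => Part.some (p q.2 n)).map
        fun n => q.2 ++ [(Encodable.decode (α := β) n).getD d]) (by fun_prop) (fun_const []) ?_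
    refine RecursiveIn.map (g := fun (q : ℕ × ℕ × List β) n => q.2.2 ++ [(Encodable.decode (α := β) n).getD d])
      (RecursiveIn.rfind (p := fun (q : ℕ × ℕ × List β) n => p q.2.2 n) ?_) ?_
    · exact comp₂ (g := fun q : (ℕ × ℕ × List β) × ℕ => q.1.2.2) hp (by fun_prop) (by fun_prop)
    · unfold ComputableIn₂
      fun_prop
  have hstep : ∀ k l, l ∈ L k → inv l → ∃ b, check l b = true ∧ l ++ [b] ∈ L (k + 1) := by
    intro k l hl hinv
    obtain ⟨n, hn⟩ := hex l hinv
    have hd : (Nat.rfind fun n => Part.some (p l n)).Dom :=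
      Nat.rfind_dom.2 ⟨n, by simpa using hn, fun _ => trivial⟩
    have hm := Part.get_mem hd
    have hsp := Nat.rfind_spec hm
    refine ⟨_, ?_, Part.mem_bind hl (Part.mem_map _ hm)⟩
    have : p l ((Nat.rfind fun n => Part.some (p l n)).get hd) = true := by simpa using hsp
    simp only [p, Bool.and_eq_true] at this
    exact this.2
  have hdef : ∀ k, ∃ l ∈ L k, inv l ∧ l.length = k := by
    intro k
    induction k with
    | zero => exact ⟨[], Part.mem_some _, h0, rfl⟩
    | succ k ih =>
      obtain ⟨l, hl, hinv, hlen⟩ := ih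
      obtain ⟨b, hb, hlb⟩ := hstep k l hl hinv
      exact ⟨_, hlb, hi l b hinv hb, by simp [hlen]⟩
  choose l hl hinv hlen using hdef
  have hlc : ComputableIn O l := RecursiveIn.of_eq_tot hL hl
  have hsucc : ∀ k, ∃ b, check (l k) b = true ∧ l (k + 1) = l k ++ [b] := fun k => by
    obtain ⟨b, hb, hlb⟩ := hstep k (l k) (hl k) (hinv k)
    exact ⟨b, hb, Part.mem_unique (hl _) hlb⟩
  have hs' : ∀ k, check (l k) ((l (k + 1)).getD k d) = true ∧
      l (k + 1) = l k ++ [(l (k + 1)).getD k d] := fun k => by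
    obtain ⟨b, hb, hlb⟩ := hsucc k
    have : (l (k + 1)).getD k d = b := by rw [hlb]; simp [hlen k]
    rw [this]; exact ⟨hb, hlb⟩
  have hrange : ∀ k, (List.range k).map (fun k => (l (k + 1)).getD k d) = l k := by
    intro k
    induction k with
    | zero => simpa using (List.eq_nil_of_length_eq_zero (hlen 0)).symm
    | succ k ih => rw [List.range_succ, List.map_append, ih, (hs' k).2]; simp
  refine ⟨fun k => (l (k + 1)).getD k d, by fun_prop, fun k => ?_⟩
  rw [hrange k]
  exact ⟨hinv k, (hs' k).1⟩

end ComputableIn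

end RelativeComputability

namespace ContRand

/-! ### Strings, cylinders and compactness -/

@[simp]
theorem length_restr (y : Cantor) (n : ℕ) : (restr y n).length = n := by simp [restr]

@[simp]
theorem restr_zero (y : Cantor) : restr y 0 = [] := rfl

theorem restr_succ (y : Cantor) (n : ℕ) : restr y (n + 1) = restr y n ++ [y n] := by
  simp [restr, List.range_succ]

theorem getElem_restr (y : Cantor) (n i : ℕ) (h : i < (restr y n).length) :
    (restr y n)[i] = y i := by
  simp [restr]

theorem take_restr (y : Cantor) {k n : ℕ} (h : k ≤ n) : (restr y n).take k = restr y k := by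
  simp [restr, ← List.map_take, List.take_range, h]

theorem restr_prefix (y : Cantor) {k n : ℕ} (h : k ≤ n) : restr y k <+: restr y n := by
  rw [← take_restr y h]
  exact List.take_prefix _ _

theorem mem_cyl {y : Cantor} {σ : Str} : y ∈ cyl σ ↔ restr y σ.length = σ := Iff.rfl

theorem mem_cyl_iff_getElem {y : Cantor} {σ : Str} :
    y ∈ cyl σ ↔ ∀ i (h : i < σ.length), y i = σ[i] := by
  rw [mem_cyl]
  constructor
  · intro h i hi
    have := getElem_restr y σ.length i (by simpa using hi)
    rw [← this]
    congr 1
  · intro h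
    refine List.ext_getElem (by simp) fun i h₁ h₂ => ?_
    rw [getElem_restr, h]

theorem mem_cyl_restr (y : Cantor) (n : ℕ) : y ∈ cyl (restr y n) := by simp [mem_cyl]

theorem mem_cyl_restr_iff {y w : Cantor} {n : ℕ} : w ∈ cyl (restr y n) ↔ restr w n = restr y n := by
  simp [mem_cyl]

theorem prefix_restr_iff {y : Cantor} {σ : Str} {n : ℕ} (h : σ.length ≤ n) :
    σ <+: restr y n ↔ y ∈ cyl σ := by
  rw [mem_cyl, List.prefix_iff_eq_take, take_restr y h, eq_comm]

theorem cyl_anti {σ τ : Str} (h : σ <+: τ) : cyl τ ⊆ cyl σ := fun y hy => by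
  rw [mem_cyl] at hy
  rw [← prefix_restr_iff h.length_le, hy]
  exact h

theorem prefix_of_mem_cyl {y : Cantor} {σ τ : Str} (hσ : y ∈ cyl σ) (hτ : y ∈ cyl τ)
    (h : σ.length ≤ τ.length) : σ <+: τ := by
  rw [mem_cyl] at hτ
  rw [← hτ, prefix_restr_iff h]
  exact hσ

theorem prefix_or_prefix_of_mem_cyl {y : Cantor} {σ τ : Str} (hσ : y ∈ cyl σ) (hτ : y ∈ cyl τ) :
    σ <+: τ ∨ τ <+: σ :=
  (le_total σ.length τ.length).imp (prefix_of_mem_cyl hσ hτ) (prefix_of_mem_cyl hτ hσ)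

theorem eq_of_restr_eq {y w : Cantor} (h : ∀ n, ∃ k, n ≤ k ∧ restr y k = restr w k) : y = w := by
  funext n
  obtain ⟨k, hk, h⟩ := h (n + 1)
  have h₁ := getElem_restr y k n (by simpa using hk)
  have h₂ := getElem_restr w k n (by simpa using hk)
  rw [← h₁, ← h₂]
  congr 1

theorem padZero_mem_cyl (σ : Str) : padZero σ ∈ cyl σ := by
  rw [mem_cyl_iff_getElem]
  intro i hi
  simp [padZero, hi]

theorem restr_padZero (σ : Str) : restr (padZero σ) σ.length = σ := padZero_mem_cyl σ

theorem isClopen_cyl (σ : Str) : IsClopen (cyl σ) := by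
  have : cyl σ = ⋂ i : Fin σ.length, (fun y : Cantor => y i) ⁻¹' {σ[i]} := by
    ext y
    simp only [mem_cyl_iff_getElem, Set.mem_iInter, Set.mem_preimage, Set.mem_singleton_iff]
    exact ⟨fun h i => h i i.2, fun h i hi => h ⟨i, hi⟩⟩
  rw [this]
  exact isClopen_iInter_of_finite fun i => (isClopen_discrete _).preimage (continuous_apply _)

theorem measurableSet_cyl (σ : Str) : MeasurableSet (cyl σ) := (isClopen_cyl σ).isOpen.measurableSet

theorem disjoint_cyl {σ τ : Str} (h : σ.length = τ.length) (hne : σ ≠ τ) :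
    Disjoint (cyl σ) (cyl τ) :=
  Set.disjoint_left.2 fun _ hσ hτ => hne ((prefix_of_mem_cyl hσ hτ h.le).eq_of_length h)

/-- König's lemma. -/
theorem exists_level {T : Str → Prop} (hT : ∀ σ τ, σ <+: τ → T σ → T τ)
    (h : ∀ y : Cantor, ∃ k, T (restr y k)) : ∃ k, ∀ σ : Str, k ≤ σ.length → T σ := by
  choose k hk using h
  obtain ⟨t, -, ht⟩ := isCompact_univ.elim_nhds_subcover (fun y => cyl (restr y (k y)))
    fun y _ => (isClopen_cyl _).isOpen.mem_nhds (mem_cyl_restr y _)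
  refine ⟨t.sup k, fun σ hσ => ?_⟩
  -- Any point of `cyl σ` would do. The covering cylinder that contains it belongs to a string no
  -- longer than `σ`, hence to a prefix of `σ`.
  obtain ⟨y, hy, hm⟩ := Set.mem_iUnion₂.1 (ht (Set.mem_univ (padZero σ)))
  refine hT _ _ ?_ (hk y)
  have hle : (restr y (k y)).length ≤ σ.length := by
    rw [length_restr]
    exact (Finset.le_sup (f := k) hy).trans hσ
  exact prefix_of_mem_cyl hm (padZero_mem_cyl σ) hle

/-! ### Lebesgue measure and total mass of a level -/

theorem lebesgue_cyl (σ : Str) : lebesgue (cyl σ) = (2⁻¹ : ℝ≥0∞) ^ σ.length := by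
  have : cyl σ = Set.pi (Finset.range σ.length : Set ℕ) fun i => {σ.getD i false} := by
    ext y
    simp only [mem_cyl_iff_getElem, Set.mem_pi, Finset.coe_range, Set.mem_Iio,
      Set.mem_singleton_iff]
    refine forall₂_congr fun i hi => ?_
    rw [List.getD_eq_getElem _ _ hi]
  rw [this, lebesgue, Measure.infinitePi_pi _ fun _ _ => .singleton _]
  simp

instance : IsProbabilityMeasure lebesgue := by
  unfold lebesgue
  infer_instance

theorem isContinuous_lebesgue : IsContinuous lebesgue := fun y => by
  refine le_antisymm (ENNReal.le_of_forall_pos_le_add fun ε hε _ => ?_) bot_le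
  obtain ⟨n, hn⟩ := ENNReal.exists_inv_two_pow_lt (a := (ε : ℝ≥0∞)) (by simpa using hε.ne')
  rw [zero_add]
  refine (measure_mono (Set.singleton_subset_iff.2 (mem_cyl_restr y n))).trans ?_
  rw [lebesgue_cyl, length_restr]
  exact hn.le

theorem sum_measureReal_cyl (μ : Measure Cantor) [IsProbabilityMeasure μ] (n : ℕ) :
    ∑ s : Fin n → Bool, μ.real (cyl (List.ofFn s)) = 1 := by
  rw [← measureReal_iUnion_fintype]
  · have : (⋃ s : Fin n → Bool, cyl (List.ofFn s)) = Set.univ := by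
      refine Set.eq_univ_of_forall fun y => Set.mem_iUnion.2 ⟨fun i => y i, ?_⟩
      rw [mem_cyl_iff_getElem]
      simp
    rw [this]; simp
  · intro s t hst
    exact disjoint_cyl (by simp) fun h => hst (List.ofFn_injective h)
  · exact fun s => measurableSet_cyl _

/-! ### Recursive functionals -/

/-- Monotonicity makes the outputs along `y` compatible, so bit `n` may be read from any output
longer than `n`. -/
theorem exists_functional {φ : Str → Str} (hmono : ∀ σ τ : Str, σ <+: τ → φ σ <+: φ τ)
    (hlen : ∀ (y : Cantor) n, ∃ k, n ≤ (φ (restr y k)).length) :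
    ∃ Φ : Cantor → Cantor, ∀ y k, Φ y ∈ cyl (φ (restr y k)) := by
  choose k hk using hlen
  refine ⟨fun y n => (φ (restr y (k y (n + 1)))).getD n false, fun y j => ?_⟩
  rw [mem_cyl_iff_getElem]
  intro i hi
  have h₁ : i < (φ (restr y (k y (i + 1)))).length := hk y (i + 1)
  dsimp only
  rw [List.getD_eq_getElem _ _ h₁]
  rcases le_total j (k y (i + 1)) with h | h
  · exact ((hmono _ _ (restr_prefix y h)).getElem hi).symm
  · exact (hmono _ _ (restr_prefix y h)).getElem h₁

/-- Each output bit is already decided by some finite initial segment of the argument. -/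
theorem RecursiveFunctional.continuous {z : Cantor} {Φ : Cantor → Cantor}
    (h : RecursiveFunctional z Φ) : Continuous Φ := by
  obtain ⟨φ, -, -, hφ⟩ := h
  refine continuous_pi fun n => continuous_discrete_rng.2 fun b => ?_
  refine isOpen_iff_forall_mem_open.2 fun y hy => ?_
  obtain ⟨k, hk⟩ := (hφ y).2 (n + 1)
  refine ⟨cyl (restr y k), fun w hw => ?_, (isClopen_cyl _).isOpen, mem_cyl_restr y k⟩
  have h₁ := mem_cyl_iff_getElem.1 ((hφ y).1 k) n hk
  have h₂ := (hφ w).1 k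
  rw [mem_cyl_restr_iff.1 hw] at h₂
  have h₃ := mem_cyl_iff_getElem.1 h₂ n hk
  simp only [Set.mem_preimage, Set.mem_singleton_iff] at hy ⊢
  rw [h₃, ← h₁, hy]

theorem RecursiveFunctional.measurable {z : Cantor} {Φ : Cantor → Cantor}
    (h : RecursiveFunctional z Φ) : Measurable Φ :=
  h.continuous.measurable

/-- The values of the longest initial segment of `l` that consists of defined values. -/
def somePrefix : List (Option Bool) → Str
  | [] => []
  | none :: _ => []
  | some b :: l => b :: somePrefix l

theorem somePrefix_eq_map_takeWhile (l : List (Option Bool)) :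
    somePrefix l = (l.takeWhile Option.isSome).map fun o => o.getD false := by
  induction l with
  | nil => rfl
  | cons o l ih => cases o <;> simp [somePrefix, ih]

theorem getElem?_somePrefix (l : List (Option Bool)) (i : ℕ) (b : Bool) :
    (somePrefix l)[i]? = some b → l[i]? = some (some b) := by
  induction l generalizing i with
  | nil => simp [somePrefix]
  | cons o l ih =>
    cases o with
    | none => simp [somePrefix]
    | some c => cases i with
      | zero => simp [somePrefix]
      | succ i => simpa [somePrefix] using ih i

theorem le_length_somePrefix (l : List (Option Bool)) (n : ℕ)
    (h : ∀ i < n, ∃ b, l[i]? = some (some b)) : n ≤ (somePrefix l).length := by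
  induction l generalizing n with
  | nil =>
    rcases n with _ | n
    · simp
    · simpa using h 0 (by simp)
  | cons o l ih =>
    rcases n with _ | n
    · simp
    · obtain ⟨b, hb⟩ := h 0 (by simp)
      obtain rfl : o = some b := by simpa using hb
      have := ih n fun i hi => by simpa using h (i + 1) (by omega)
      simpa [somePrefix] using this

theorem somePrefix_prefix (l l' : List (Option Bool))
    (h : ∀ (i : ℕ) b, l[i]? = some (some b) → l'[i]? = some (some b)) :
    somePrefix l <+: somePrefix l' := by
  induction l generalizing l' with
  | nil => simp [somePrefix]
  | cons o l ih =>
    cases o with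
    | none => simp [somePrefix]
    | some c =>
      have h0 := h 0 c (by simp)
      rcases l' with _ | ⟨o', l'⟩
      · simp at h0
      · obtain rfl : o' = some c := by simpa using h0
        simpa [somePrefix] using ih l' fun i b hi => by simpa using h (i + 1) b (by simpa using hi)

/-- A map on Cantor space is a recursive functional if its bits can be computed from
sufficiently long initial segments of the argument. -/
theorem RecursiveFunctional.of_bits {z : Cantor} {Φ : Cantor → Cantor}
    (B : ℕ → Str → Option Bool) (hB : ComputableIn {oracle z} fun p : ℕ × Str => B p.1 p.2)
    (hmono : ∀ n σ τ b, σ <+: τ → B n σ = some b → B n τ = some b)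
    (hconv : ∀ y n, ∃ k, B n (restr y k) = some (Φ y n)) : RecursiveFunctional z Φ := by
  refine ⟨fun σ => somePrefix ((List.range σ.length).map fun n => B n σ), ?_, ?_, ?_⟩
  · simp only [somePrefix_eq_map_takeWhile]
    have h₁ : ComputableIn {oracle z} fun l : List (Option Bool) => l.takeWhile Option.isSome :=
      (Primrec.list_takeWhile Primrec.option_isSome).computableIn
    have h₂ : ComputableIn {oracle z} fun σ : Str => (List.range σ.length).map fun n => B n σ :=
      ComputableIn.list_map (by fun_prop)
        (ComputableIn.comp (g := fun p : Str × ℕ => (p.2, p.1)) hB (by fun_prop))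
    fun_prop
  · intro σ τ h
    refine somePrefix_prefix _ _ fun i b hi => ?_
    have hlen := h.length_le
    rw [List.getElem?_eq_some_iff] at hi ⊢
    obtain ⟨h₁, h₂⟩ := hi
    simp only [List.length_map, List.length_range, List.getElem_map, List.getElem_range] at h₁ h₂
    exact ⟨by simp; omega, by simpa using hmono _ _ _ _ h h₂⟩
  · intro y
    have hval : ∀ k n b, B n (restr y k) = some b → b = Φ y n := fun k n b hb => by
      obtain ⟨j, hj⟩ := hconv y n
      rcases le_total k j with h | h
      · have := hmono _ _ _ _ (restr_prefix y h) hb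
        simpa [this] using hj
      · have := hmono _ _ _ _ (restr_prefix y h) hj
        simpa [hb] using this
    constructor
    · intro k
      rw [mem_cyl_iff_getElem]
      intro i hi
      have := getElem?_somePrefix _ i _ (List.getElem?_eq_getElem hi)
      rw [List.getElem?_eq_some_iff] at this
      obtain ⟨h₁, h₂⟩ := this
      simp only [List.getElem_map, List.getElem_range] at h₂
      exact (hval _ _ _ h₂).symm
    · intro n
      choose k hk using hconv y
      refine ⟨n + (Finset.range n).sup k, le_length_somePrefix _ _ fun i hi => ⟨Φ y i, ?_⟩⟩
      rw [List.getElem?_eq_some_iff]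
      refine ⟨by simp; omega, ?_⟩
      simp only [List.getElem_map, List.getElem_range]
      refine hmono _ _ _ _ (restr_prefix y ?_) (hk i)
      exact (Finset.le_sup (f := k) (Finset.mem_range.2 hi)).trans (Nat.le_add_left _ _)

/-- The list of all strings of length `n`. -/
def strings : ℕ → List Str
  | 0 => [[]]
  | n + 1 => (strings n).map (List.cons false) ++ (strings n).map (List.cons true)

theorem mem_strings {n : ℕ} {σ : Str} : σ ∈ strings n ↔ σ.length = n := by
  induction n generalizing σ with
  | zero => simp [strings]
  | succ n ih =>
    rcases σ with _ | ⟨b, σ⟩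
    · simp [strings]
    · cases b <;> simp [strings, ih]

theorem length_strings (n : ℕ) : (strings n).length = 2 ^ n := by
  induction n with
  | zero => rfl
  | succ n ih => simp [strings, ih, pow_succ, mul_two]

theorem nodup_strings (n : ℕ) : (strings n).Nodup := by
  induction n with
  | zero => simp [strings]
  | succ n ih =>
    refine List.Nodup.append (ih.map (List.cons_injective)) (ih.map (List.cons_injective)) ?_
    intro σ h₁ h₂
    simp only [List.mem_map] at h₁ h₂
    obtain ⟨a, -, rfl⟩ := h₁
    obtain ⟨b, -, h⟩ := h₂
    simp at h

theorem computableIn_strings {O : Set (ℕ →. ℕ)} : ComputableIn O strings := by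
  refine (ComputableIn.nat_rec (f := fun n => n) (g := fun _ => [[]])
    (h := fun (_ : ℕ) (p : ℕ × List Str) => p.2.map (List.cons false) ++ p.2.map (List.cons true))
    (by fun_prop) (by fun_prop) (by unfold ComputableIn₂; fun_prop)).of_eq fun n => ?_
  induction n with
  | zero => rfl
  | succ n ih => simp only [strings, ← ih]

/-! ### Conservation of randomness -/

/-- `ρ` is a minimal string whose image under `φ` extends `σ`. -/
def IsMinimalAbove (φ : Str → Str) (σ ρ : Str) : Prop :=
  σ <+: φ ρ ∧ (ρ.length = 0 ∨ ¬ σ <+: φ (ρ.take (ρ.length - 1)))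

theorem exists_isMinimalAbove {φ : Str → Str} {σ : Str} {y : Cantor}
    (h : ∃ k, σ <+: φ (restr y k)) : ∃ k, IsMinimalAbove φ σ (restr y k) := by
  classical
  refine ⟨Nat.find h, Nat.find_spec h, ?_⟩
  rw [length_restr]
  refine (Nat.eq_zero_or_pos _).imp id fun h0 => ?_
  rw [take_restr y (Nat.sub_le _ _)]
  exact Nat.find_min h (by omega)

theorem IsMinimalAbove.eq_of_prefix {φ : Str → Str}
    (hmono : ∀ σ τ : Str, σ <+: τ → φ σ <+: φ τ) {σ ρ ρ' : Str} (h : IsMinimalAbove φ σ ρ)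
    (h' : IsMinimalAbove φ σ ρ') (hp : ρ <+: ρ') : ρ = ρ' := by
  by_contra hne
  have hlt : ρ.length < ρ'.length :=
    lt_of_le_of_ne hp.length_le fun he => hne (hp.eq_of_length he)
  rcases h'.2 with h0 | h0
  · omega
  · refine h0 (h.1.trans (hmono _ _ ?_))
    rw [List.prefix_take_iff]
    exact ⟨hp, by omega⟩

/-- The minimal strings form an antichain, so their cylinders are disjoint, and monotonicity of `φ`
puts each of them inside the preimage of `cyl σ`. -/
theorem tsum_isMinimalAbove_le {φ : Str → Str} (hmono : ∀ σ τ : Str, σ <+: τ → φ σ <+: φ τ)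
    {Φ : Cantor → Cantor} (hφ : ∀ y k, Φ y ∈ cyl (φ (restr y k))) (μ : Measure Cantor) (σ : Str) :
    ∑' ρ : {ρ | IsMinimalAbove φ σ ρ}, μ (cyl ρ) ≤ μ (Φ ⁻¹' cyl σ) := by
  rw [← measure_iUnion]
  · refine measure_mono (Set.iUnion_subset fun ρ y hy => ?_)
    have := hφ y ρ.1.length
    rw [mem_cyl.1 hy] at this
    exact cyl_anti ρ.2.1 this
  · intro ρ ρ' hne
    refine Set.disjoint_left.2 fun y h h' => hne (Subtype.ext ?_)
    rcases prefix_or_prefix_of_mem_cyl h h' with hp | hp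
    · exact ρ.2.eq_of_prefix hmono ρ'.2 hp
    · exact (ρ'.2.eq_of_prefix hmono ρ.2 hp).symm
  · exact fun ρ => measurableSet_cyl _

/-- If the image of `μ` under a recursive functional is bounded by a multiple of `ν`, then the
functional maps points random for `μ` to points random for `ν`. -/
theorem PassesTests.map {O : Set (ℕ →. ℕ)} {z : Cantor} (hz : oracle z ∈ O) {Φ : Cantor → Cantor}
    (hΦ : RecursiveFunctional z Φ) {μ ν : Measure Cantor} (c : ℕ)
    (hμ : ∀ σ, μ (Φ ⁻¹' cyl σ) ≤ 2 ^ c * ν (cyl σ)) {x : Cantor} (hx : PassesTests O μ x) :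
    PassesTests O ν (Φ x) := by
  obtain ⟨φ, hcomp, hmono, hφ⟩ := hΦ
  replace hcomp : ComputableIn O φ := hcomp.mono (by simpa using hz)
  intro U hU hmem
  obtain ⟨e, he, heU⟩ := hU.enumerable
  -- The shift by `c` absorbs the factor `2 ^ c`. Only minimal strings are enumerated, since other
  -- strings above `σ` would be counted again in the sum.
  refine hx (fun n => ⋃ σ ∈ U (n + c), {ρ | IsMinimalAbove φ σ ρ}) ⟨?_, fun n => ?_⟩ ?_
  · let m : Str → Str → Bool := fun σ ρ => decide ((φ ρ).take σ.length = σ) &&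
      (decide (ρ.length = 0) || !decide ((φ (ρ.take (ρ.length - 1))).take σ.length = σ))
    have hm : ∀ σ ρ, m σ ρ = true ↔ IsMinimalAbove φ σ ρ := fun σ ρ => by
      simp only [m, IsMinimalAbove, List.prefix_iff_eq_take, Bool.and_eq_true, Bool.or_eq_true,
        decide_eq_true_eq, Bool.not_eq_true', decide_eq_false_iff_not, @eq_comm _ σ]
    -- Stage `s` codes a stage of the given enumeration together with a candidate string, which is
    -- then tested for minimality.
    let e' : ℕ → ℕ → Option Str := fun n s =>
      bif (e (n + c) s.unpair.1).isSome && ((Encodable.decode s.unpair.2 : Option Str).isSome &&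
        m ((e (n + c) s.unpair.1).getD []) ((Encodable.decode s.unpair.2 : Option Str).getD []))
      then some ((Encodable.decode s.unpair.2 : Option Str).getD []) else none
    refine ⟨e', ?_, fun n ρ => ?_⟩
    · have h₁ : ComputableIn O fun p : ℕ × ℕ => e (p.1 + c) p.2.unpair.1 :=
        ComputableIn.comp₂ he (by fun_prop) (by fun_prop)
      have h₂ : ComputableIn O fun p : Option Str × Option Str =>
          bif p.1.isSome && (p.2.isSome && m (p.1.getD []) (p.2.getD []))
          then some (p.2.getD []) else none := by
        unfold m
        fun_prop
      exact ComputableIn.comp (g := fun p : ℕ × ℕ =>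
        (e (p.1 + c) p.2.unpair.1, (Encodable.decode p.2.unpair.2 : Option Str))) h₂
        (h₁.prodMk (by fun_prop))
    · simp only [Set.mem_iUnion, Set.mem_ofPred_eq, exists_prop]
      constructor
      · rintro ⟨σ, hσ, hρ⟩
        obtain ⟨s, hs⟩ := (heU _ _).1 hσ
        exact ⟨Nat.pair s (Encodable.encode ρ), by simp [e', hs, (hm σ ρ).2 hρ]⟩
      · rintro ⟨s, hs⟩
        simp only [e', cond_eq_ite, Bool.and_eq_true, Option.ite_none_right_eq_some,
          Option.some.injEq] at hs
        obtain ⟨⟨h₁, h₂, h₃⟩, rfl⟩ := hs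
        obtain ⟨σ, hσ⟩ := Option.isSome_iff_exists.1 h₁
        refine ⟨σ, (heU _ _).2 ⟨_, hσ⟩, ?_⟩
        rw [hσ] at h₃
        exact (hm _ _).1 h₃
  · calc ∑' ρ : ⋃ σ ∈ U (n + c), {ρ | IsMinimalAbove φ σ ρ}, μ (cyl ρ)
        ≤ ∑' σ : U (n + c), ∑' ρ : {ρ | IsMinimalAbove φ σ ρ}, μ (cyl ρ) :=
          ENNReal.tsum_biUnion_le_tsum (fun ρ => μ (cyl ρ)) _ _
      _ ≤ ∑' σ : U (n + c), 2 ^ c * ν (cyl σ) := ENNReal.tsum_le_tsum fun σ =>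
          (tsum_isMinimalAbove_le hmono (fun y => (hφ y).1) μ σ).trans (hμ σ)
      _ = 2 ^ c * ∑' σ : U (n + c), ν (cyl σ) := ENNReal.tsum_mul_left
      _ ≤ 2 ^ c * 2⁻¹ ^ (n + c) := by gcongr; exact hU.measure_le _
      _ = 2⁻¹ ^ n := by
          rw [pow_add, mul_comm, mul_assoc, ← mul_pow,
            ENNReal.inv_mul_cancel two_ne_zero ENNReal.ofNat_ne_top, one_pow, mul_one]
  · refine Set.mem_iInter.2 fun n => ?_
    obtain ⟨σ, hσ, hxσ⟩ := Set.mem_iUnion₂.1 (Set.mem_iInter.1 hmem (n + c))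
    obtain ⟨k, hk⟩ := (hφ x).2 σ.length
    obtain ⟨j, hj⟩ := exists_isMinimalAbove ⟨k, prefix_of_mem_cyl hxσ ((hφ x).1 k) hk⟩
    exact Set.mem_iUnion₂.2 ⟨_, Set.mem_iUnion₂.2 ⟨σ, hσ, hj⟩, mem_cyl_restr x j⟩

/-- Stronger oracles enumerate more tests, so passing them is the stronger condition. -/
theorem PassesTests.mono {O O' : Set (ℕ →. ℕ)} (h : ∀ g ∈ O, RecursiveIn O' g)
    {μ : Measure Cantor} {x : Cantor} (hx : PassesTests O' μ x) : PassesTests O μ x :=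
  fun U hU => hx U ⟨by
    obtain ⟨e, he, heU⟩ := hU.enumerable
    exact ⟨e, RecursiveIn.subst he h, heU⟩, hU.measure_le⟩

/-- Adding a representation recursive in `z` to the oracle `z` changes nothing. -/
theorem randomRel_of_passesTests {μ : Measure Cantor} {p : ℕ → Code} {z x : Cantor}
    (hp : ComputableIn {oracle z} p) (hx : PassesTests {oracle z} μ x) : RandomRel μ p z x := by
  refine hx.mono fun g hg => ?_
  rcases hg with rfl | rfl
  · exact ComputableIn.of_primrec_comp Primrec.encode hp
  · exact RecursiveIn.oracle _ rfl

/-! ### Codes and representations -/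

theorem list_sum_smul_dirac_apply (c : Code) (T : ℝ≥0∞) {S : Set Cantor} (hS : MeasurableSet S)
    (P : Str → Bool) (hP : ∀ σ, P σ = true ↔ padZero σ ∈ S) :
    (c.map fun e => ((e.2 : ℝ≥0∞) / T) • Measure.dirac (padZero e.1)).sum S =
      ((c.map fun e => bif P e.1 then e.2 else 0).sum : ℕ) / T := by
  induction c with
  | nil => simp
  | cons e c ih =>
    simp only [List.map_cons, List.sum_cons, Measure.add_apply, ih, Measure.smul_apply,
      Measure.dirac_apply' _ hS, smul_eq_mul, Nat.cast_add, ENNReal.add_div]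
    congr 1
    by_cases h : padZero e.1 ∈ S
    · simp [h, (hP _).2 h]
    · have : P e.1 = false := by simpa using mt (hP _).1 h
      simp [h, this]

theorem Code.measure_apply (c : Code) {S : Set Cantor} (hS : MeasurableSet S)
    (P : Str → Bool) (hP : ∀ σ, P σ = true ↔ padZero σ ∈ S) :
    c.measure S = ((c.map fun e => bif P e.1 then e.2 else 0).sum : ℕ) / (c.total : ℝ≥0∞) :=
  list_sum_smul_dirac_apply c _ hS P hP

theorem Code.isProbabilityMeasure {c : Code} (h : 0 < c.total) :
    IsProbabilityMeasure c.measure := ⟨by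
  rw [c.measure_apply .univ (fun _ => true) (by simp)]
  simp only [cond_true]
  exact ENNReal.div_self (by exact_mod_cast h.ne') (ENNReal.natCast_ne_top _)⟩

/-- The distance of two measures on the strings of length `n`. -/
noncomputable def levelDist (μ ν : Measure Cantor) (n : ℕ) : ℝ :=
  ∑ s : Fin n → Bool, |μ.real (cyl (List.ofFn s)) - ν.real (cyl (List.ofFn s))|

theorem levelDist_nonneg (μ ν : Measure Cantor) (n : ℕ) : 0 ≤ levelDist μ ν n :=
  Finset.sum_nonneg fun _ _ => abs_nonneg _

theorem levelDist_le (μ ν : Measure Cantor) [IsProbabilityMeasure μ] [IsProbabilityMeasure ν]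
    (n : ℕ) : levelDist μ ν n ≤ 2 := by
  calc levelDist μ ν n
      ≤ ∑ s : Fin n → Bool, (μ.real (cyl (List.ofFn s)) + ν.real (cyl (List.ofFn s))) := by
        refine Finset.sum_le_sum fun s _ => ?_
        have h₁ : 0 ≤ μ.real (cyl (List.ofFn s)) := measureReal_nonneg
        have h₂ : 0 ≤ ν.real (cyl (List.ofFn s)) := measureReal_nonneg
        rw [abs_le]
        constructor <;> linarith
    _ = 2 := by
        rw [Finset.sum_add_distrib, sum_measureReal_cyl, sum_measureReal_cyl]
        norm_num

theorem measDist_eq (μ ν : Measure Cantor) :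
    measDist μ ν = ∑' n : ℕ, (1 / 2 : ℝ) ^ (n + 1) * ((1 / 2) * levelDist μ ν (n + 1)) := rfl

theorem measDist_term_le (μ ν : Measure Cantor) [IsProbabilityMeasure μ] [IsProbabilityMeasure ν]
    (n : ℕ) : (1 / 2 : ℝ) ^ (n + 1) * ((1 / 2) * levelDist μ ν (n + 1)) ≤ (1 / 2) ^ (n + 1) := by
  have := levelDist_le μ ν (n + 1)
  exact mul_le_of_le_one_right (by positivity) (by linarith)

theorem measDist_term_nonneg (μ ν : Measure Cantor) (n : ℕ) :
    0 ≤ (1 / 2 : ℝ) ^ (n + 1) * ((1 / 2) * levelDist μ ν (n + 1)) := by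
  have := levelDist_nonneg μ ν (n + 1)
  positivity

theorem summable_half_pow_succ : Summable fun n : ℕ => (1 / 2 : ℝ) ^ (n + 1) :=
  (summable_nat_add_iff 1).2 (summable_geometric_of_lt_one (by norm_num) (by norm_num))

theorem summable_measDist (μ ν : Measure Cantor) [IsProbabilityMeasure μ]
    [IsProbabilityMeasure ν] :
    Summable fun n : ℕ => (1 / 2 : ℝ) ^ (n + 1) * ((1 / 2) * levelDist μ ν (n + 1)) :=
  Summable.of_nonneg_of_le (measDist_term_nonneg μ ν) (measDist_term_le μ ν)
    summable_half_pow_succ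

/-- A single term of the series is at most its sum; its weight is `2 ^ (-(k + 2))`, the factor 1/2
in the metric included. -/
theorem levelDist_le_of_measDist_le {μ ν : Measure Cantor} [IsProbabilityMeasure μ]
    [IsProbabilityMeasure ν] {n : ℕ} (h : measDist μ ν ≤ (1 / 2) ^ n) (k : ℕ) :
    levelDist μ ν (k + 1) ≤ 2 ^ (k + 2) / 2 ^ n := by
  have h₁ := (summable_measDist μ ν).le_tsum k fun j _ => measDist_term_nonneg μ ν j
  rw [← measDist_eq] at h₁
  have h₂ := h₁.trans h
  rw [div_pow, div_pow, one_pow, one_pow] at h₂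
  rw [show levelDist μ ν (k + 1) = 2 ^ (k + 2) *
    (1 / 2 ^ (k + 1) * (1 / 2 * levelDist μ ν (k + 1))) by field_simp; ring]
  calc _ ≤ (2 : ℝ) ^ (k + 2) * (1 / 2 ^ n) := by gcongr
    _ = _ := by ring

/-- Only the tail of the series remains, and it is dominated by a geometric series with sum `2 ^
(-n)`. -/
theorem measDist_le_of_levelDist_eq_zero {μ ν : Measure Cantor} [IsProbabilityMeasure μ]
    [IsProbabilityMeasure ν] {n : ℕ} (h : ∀ k < n, levelDist μ ν (k + 1) = 0) :
    measDist μ ν ≤ (1 / 2) ^ n := by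
  rw [measDist_eq, ← (summable_measDist μ ν).sum_add_tsum_nat_add n,
    Finset.sum_eq_zero fun k hk => by rw [h k (Finset.mem_range.1 hk)]; simp, zero_add]
  calc _ ≤ ∑' k : ℕ, (1 / 2 : ℝ) ^ (k + n + 1) :=
        ((summable_nat_add_iff n).2 (summable_measDist μ ν)).tsum_le_tsum
          (fun k => measDist_term_le μ ν (k + n))
          ((summable_nat_add_iff n).2 summable_half_pow_succ)
    _ = ∑' k : ℕ, (1 / 2 : ℝ) ^ (n + 1) * (1 / 2) ^ k := by
        congr 1; funext k; rw [← pow_add]; congr 1; omega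
    _ = (1 / 2) ^ n := by
        rw [tsum_mul_left, tsum_geometric_of_lt_one (by norm_num) (by norm_num)]
        ring

/-- The code of the uniform distribution on the points `φ ρ 000…`, where `|ρ| = k`. -/
def imageCode (φ : Str → Str) (k : ℕ) : Code := (strings k).map fun ρ => (φ ρ, 1)

theorem total_imageCode (φ : Str → Str) (k : ℕ) : (imageCode φ k).total = 2 ^ k := by
  simp [imageCode, Code.total, Function.comp_def, length_strings]

/-- Once `k` input bits determine `|τ|` output bits, each cylinder of level `k` is mapped either
into `cyl τ` or off it. Counting the first kind gives the exact measure, not just an approximation.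
-/
theorem measure_imageCode_cyl {φ : Str → Str} {Φ : Cantor → Cantor} (hmeas : Measurable Φ)
    (hφ : ∀ y k, Φ y ∈ cyl (φ (restr y k))) {k : ℕ} {τ : Str}
    (hk : ∀ ρ : Str, ρ.length = k → τ.length ≤ (φ ρ).length) :
    (imageCode φ k).measure (cyl τ) = lebesgue.map Φ (cyl τ) := by
  have hpre : ∀ ρ : Str, ρ.length = k → ∀ y, y ∈ cyl (φ ρ) →
      (y ∈ cyl τ ↔ (φ ρ).take τ.length = τ) := by
    intro ρ hρ y hy
    rw [eq_comm, ← List.prefix_iff_eq_take]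
    exact ⟨fun hyτ => prefix_of_mem_cyl hyτ hy (hk ρ hρ), fun hp => cyl_anti hp hy⟩
  rw [Code.measure_apply _ (measurableSet_cyl τ)
    (fun σ => decide (restr (padZero σ) τ.length = τ)) (by simp [mem_cyl]), total_imageCode,
    Measure.map_apply hmeas (measurableSet_cyl τ)]
  have hdecomp : Φ ⁻¹' cyl τ = ⋃ ρ ∈ (strings k).toFinset, Φ ⁻¹' cyl τ ∩ cyl ρ := by
    ext y
    simp only [Set.mem_iUnion, Set.mem_inter_iff, exists_prop, List.mem_toFinset, mem_strings]
    exact ⟨fun hy => ⟨restr y k, by simp, hy, mem_cyl_restr y _⟩, fun ⟨_, _, hy, _⟩ => hy⟩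
  rw [hdecomp, measure_biUnion_finset]
  · rw [imageCode, List.map_map, ← List.sum_toFinset _ (nodup_strings _), Nat.cast_sum,
      div_eq_mul_inv, Finset.sum_mul]
    refine Finset.sum_congr rfl fun ρ hρ => ?_
    rw [List.mem_toFinset, mem_strings] at hρ
    have h₁ := hpre ρ hρ _ (padZero_mem_cyl _)
    rw [mem_cyl] at h₁
    by_cases hc : (φ ρ).take τ.length = τ
    · have : Φ ⁻¹' cyl τ ∩ cyl ρ = cyl ρ := Set.inter_eq_right.2 fun y hy => by
        have h₂ := hφ y ρ.length
        rw [mem_cyl.1 hy] at h₂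
        exact (hpre ρ hρ _ h₂).2 hc
      rw [this, lebesgue_cyl, hρ]
      simp [h₁.2 hc, ENNReal.inv_pow]
    · have : Φ ⁻¹' cyl τ ∩ cyl ρ = ∅ := Set.eq_empty_of_forall_notMem fun y hy => by
        have h₂ := hφ y ρ.length
        rw [mem_cyl.1 hy.2] at h₂
        exact hc ((hpre ρ hρ _ h₂).1 hy.1)
      rw [this, measure_empty]
      simp [mt h₁.1 hc]
  · intro ρ hρ ρ' hρ' hne
    simp only [List.coe_toFinset, Set.mem_ofPred_eq, mem_strings] at hρ hρ'
    exact (disjoint_cyl (hρ.trans hρ'.symm) hne).mono Set.inter_subset_right Set.inter_subset_right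
  · exact fun ρ _ => (hmeas (measurableSet_cyl τ)).inter (measurableSet_cyl ρ)

/-- The image of Lebesgue measure under a recursive functional is dyadic and has a recursive
representation. -/
theorem RecursiveFunctional.exists_represents {z : Cantor} {Φ : Cantor → Cantor}
    (h : RecursiveFunctional z Φ) :
    IsDyadic (lebesgue.map Φ) ∧
      ∃ p : ℕ → Code, ComputableIn {oracle z} p ∧ Represents p (lebesgue.map Φ) := by
  have hmeas := h.measurable
  obtain ⟨φ, hcomp, hmono, hφ⟩ := h
  -- Compactness bounds the use: one input length serves for all arguments, and it can be found by
  -- search.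
  have hlevel : ∀ n, ∃ k, ((strings k).all fun ρ => Nat.ble n (φ ρ).length) = true := by
    intro n
    obtain ⟨k, hk⟩ := exists_level (T := fun σ => n ≤ (φ σ).length)
      (fun σ τ hστ hσ => hσ.trans (hmono σ τ hστ).length_le) fun y => (hφ y).2 n
    refine ⟨k, ?_⟩
    simp only [List.all_eq_true, Nat.ble_eq]
    exact fun ρ hρ => hk ρ (mem_strings.1 hρ).ge
  have hst := computableIn_strings (O := {oracle z})
  obtain ⟨k, hkc, hk⟩ := ComputableIn.exists_search (O := {oracle z})
    (p := fun n k => (strings k).all fun ρ => Nat.ble n (φ ρ).length)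
    (by unfold ComputableIn₂; fun_prop) hlevel
  simp only [List.all_eq_true, Nat.ble_eq, mem_strings] at hk
  have hcyl : ∀ n, ∀ τ : Str, τ.length ≤ n →
      (imageCode φ (k n)).measure (cyl τ) = lebesgue.map Φ (cyl τ) := fun n τ hτ =>
    measure_imageCode_cyl hmeas (fun y => (hφ y).1) fun ρ hρ => hτ.trans (hk n ρ hρ)
  refine ⟨fun τ => ?_, fun n => imageCode φ (k n), by unfold imageCode; fun_prop, fun n => ?_⟩
  · rw [← hcyl τ.length τ le_rfl, Code.measure_apply _ (measurableSet_cyl τ)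
      (fun σ => decide (restr (padZero σ) τ.length = τ)) (by simp [mem_cyl]), total_imageCode,
      Nat.cast_pow, Nat.cast_two]
    exact ⟨_, k τ.length, rfl⟩
  · have hpos : 0 < (imageCode φ (k n)).total := by rw [total_imageCode]; positivity
    refine ⟨hpos, ?_⟩
    have := Code.isProbabilityMeasure hpos
    have := Measure.isProbabilityMeasure_map (μ := lebesgue) hmeas.aemeasurable
    refine measDist_le_of_levelDist_eq_zero fun j hj => Finset.sum_eq_zero fun s _ => ?_
    rw [abs_eq_zero, sub_eq_zero]
    unfold Measure.real
    rw [hcyl n]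
    simp only [List.length_ofFn]
    omega

/-! ### Inverting a recursive homeomorphism -/

/-- One of the two strings extends the other. -/
def Compat (σ τ : Str) : Prop := σ <+: τ ∨ τ <+: σ

theorem compat_iff_take {σ τ : Str} : Compat σ τ ↔ σ.take τ.length = τ.take σ.length := by
  unfold Compat
  rw [List.prefix_iff_eq_take, List.prefix_iff_eq_take]
  rcases le_total σ.length τ.length with h | h
  · rw [List.take_of_length_le h]
    constructor
    · rintro (h' | h')
      · exact h'
      · simp [h']
    · exact Or.inl
  · rw [List.take_of_length_le h]
    constructor
    · rintro (h' | h')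
      · simp [h']
      · exact h'.symm
    · exact fun h => Or.inr h.symm

theorem Compat.mono {σ σ' τ τ' : Str} (h : Compat σ' τ') (hσ : σ <+: σ') (hτ : τ <+: τ') :
    Compat σ τ := by
  rcases h with h | h
  · exact List.prefix_or_prefix_of_prefix (hσ.trans h) hτ
  · exact List.prefix_or_prefix_of_prefix hσ (hτ.trans h)

theorem compat_of_mem_cyl {y : Cantor} {σ τ : Str} (hσ : y ∈ cyl σ) (hτ : y ∈ cyl τ) :
    Compat σ τ :=
  prefix_or_prefix_of_mem_cyl hσ hτ

theorem eq_of_compat {y w : Cantor} {σ τ : Str} (h : Compat σ τ) (hσ : y ∈ cyl σ)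
    (hτ : w ∈ cyl τ) {i : ℕ} (hi : i < σ.length) (hi' : i < τ.length) : y i = w i := by
  rw [mem_cyl_iff_getElem.1 hσ i hi, mem_cyl_iff_getElem.1 hτ i hi']
  rcases h with h | h
  · exact h.getElem hi
  · exact (h.getElem hi').symm

/-- The inverse of a bijective recursive functional is a recursive functional. -/
theorem RecursiveFunctional.symm {z : Cantor} {Φ : Cantor ≃ₜ Cantor}
    (h : RecursiveFunctional z Φ) : RecursiveFunctional z Φ.symm := by
  obtain ⟨φ, hcomp, hmono, hφ⟩ := h
  -- Bit `n` of the preimage is known to be `b` when every `ρ` of length `|σ|` that is not yet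
  -- excluded by `σ` has bit `b` at `n`.
  let C : ℕ → Str → Bool → Prop := fun n σ b => n < σ.length ∧
    ∀ ρ : Str, ρ.length = σ.length → Compat (φ ρ) σ → ρ.getD n false = b
  let B' : ℕ → Str → Bool → Bool := fun n σ b => Nat.blt n σ.length &&
    (strings σ.length).all fun ρ => !decide ((φ ρ).take σ.length = σ.take (φ ρ).length) ||
      decide (ρ.getD n false = b)
  have hB' : ∀ n σ b, B' n σ b = true ↔ C n σ b := fun n σ b => by
    simp only [B', C, Bool.and_eq_true, Nat.blt_eq, decide_eq_true_eq, List.all_eq_true, mem_strings,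
      Bool.or_eq_true, Bool.not_eq_true', decide_eq_false_iff_not, compat_iff_take,
      ← imp_iff_not_or]
  let B : ℕ → Str → Option Bool := fun n σ =>
    bif B' n σ false then some false else bif B' n σ true then some true else none
  -- The condition is never vacuous: surjectivity gives a preimage of a point of `cyl σ`, and its
  -- initial segment is compatible.
  have huniq : ∀ n σ b b', C n σ b → C n σ b' → b = b' := fun n σ b b' h h' => by
    have hc : Compat (φ (restr (Φ.symm (padZero σ)) σ.length)) σ := by
      refine compat_of_mem_cyl (y := padZero σ) ?_ (padZero_mem_cyl σ)
      simpa using (hφ (Φ.symm (padZero σ))).1 σ.length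
    rw [← h.2 _ (by simp) hc, ← h'.2 _ (by simp) hc]
  have hB : ∀ n σ b, B n σ = some b ↔ C n σ b := fun n σ b => by
    simp only [B]
    rcases hf : B' n σ false with _ | _ <;> rcases ht : B' n σ true with _ | _ <;>
      have hf' := hB' n σ false <;> have ht' := hB' n σ true <;> cases b <;> simp_all
  refine RecursiveFunctional.of_bits B ?_ ?_ ?_
  · have hst := computableIn_strings (O := {oracle z})
    have h₁ : ∀ b, ComputableIn {oracle z} fun p : ℕ × Str => B' p.1 p.2 b := fun b => by
      unfold B'
      fun_prop
    have h₂ := h₁ false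
    have h₃ := h₁ true
    exact ComputableIn.cond h₂ (by fun_prop) (ComputableIn.cond h₃ (by fun_prop) (by fun_prop))
  · intro n σ τ b hστ hσ
    rw [hB] at hσ ⊢
    have hlen := hστ.length_le
    refine ⟨hσ.1.trans_le hlen, fun ρ hρ hc => ?_⟩
    have h₁ := hσ.2 (ρ.take σ.length) (by simp; omega)
      (hc.mono (hmono _ _ (List.take_prefix _ _)) hστ)
    rw [← h₁]
    have hn := hσ.1
    simp [hn]
  · intro w n
    set y := Φ.symm w with hy
    -- By injectivity a point with the wrong bit at `n` is not mapped to `w`, so some finite part of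
    -- its image already disagrees with `w`. König's lemma makes the required length uniform.
    obtain ⟨k, hk⟩ := exists_level (T := fun ρ => n < ρ.length ∧
      (ρ.getD n false = y n ∨ ¬ Compat (φ ρ) (restr w ρ.length))) (by
        rintro ρ ρ' hp ⟨h₁, h₂⟩
        refine ⟨h₁.trans_le hp.length_le, h₂.imp (fun h => ?_) fun h h' => h ?_⟩
        · rw [← h, List.getD_eq_getElem _ _ h₁, List.getD_eq_getElem _ _
            (h₁.trans_le hp.length_le)]
          exact (hp.getElem h₁).symm
        · exact h'.mono (hmono _ _ hp) (restr_prefix w hp.length_le)) (by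
        intro y'
        by_cases hyy : y' n = y n
        · exact ⟨n + 1, by simp, Or.inl (by
            rw [List.getD_eq_getElem _ _ (by simp), getElem_restr, hyy])⟩
        · have hne : Φ y' ≠ w := fun h => hyy (by rw [hy, ← h]; simp)
          obtain ⟨i, hi⟩ := Function.ne_iff.1 hne
          obtain ⟨k, hk⟩ := (hφ y').2 (i + 1)
          have hk' : i + 1 ≤ (φ (restr y' (n + 1 + i + 1 + k))).length :=
            hk.trans (hmono _ _ (restr_prefix y' (Nat.le_add_left _ _))).length_le
          refine ⟨n + 1 + i + 1 + k, by simp; omega, Or.inr fun hc => hi ?_⟩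
          exact eq_of_compat hc ((hφ y').1 _) (mem_cyl_restr w _) (by omega) (by simp; omega))
    refine ⟨k, (hB _ _ _).2 ⟨?_, fun ρ hρ hc => ?_⟩⟩
    · exact (hk (restr w k) (by simp)).1
    · rw [length_restr] at hρ
      obtain ⟨-, h | h⟩ := hk ρ hρ.ge
      · exact h
      · exact absurd (by rwa [hρ]) h

/-! ### Images of Lebesgue measure -/

/-- A point that is the image of a random point under a recursive functional with small fibres is
random for a continuous dyadic measure. -/
theorem exists_dyadic_of_recursiveFunctional {z x : Cantor} {Φ : Cantor → Cantor}
    (hΦ : RecursiveFunctional z Φ) (hfib : ∀ w, lebesgue (Φ ⁻¹' {w}) = 0)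
    (hx : MLRandomRel z x) :
    ∃ (ν : Measure Cantor) (p : ℕ → Code), IsProbabilityMeasure ν ∧ IsContinuous ν ∧ IsDyadic ν ∧
      Represents p ν ∧ ComputableIn {oracle z} p ∧ RandomRel ν p z (Φ x) := by
  obtain ⟨hd, p, hpc, hp⟩ := hΦ.exists_represents
  refine ⟨lebesgue.map Φ, p, Measure.isProbabilityMeasure_map hΦ.measurable.aemeasurable,
    fun w => ?_, hd, hp, hpc, randomRel_of_passesTests hpc ?_⟩
  · rw [Measure.map_apply hΦ.measurable (measurableSet_singleton w), hfib]
  · refine PassesTests.map (Set.mem_singleton _) hΦ 0 (fun σ => ?_) hx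
    rw [Measure.map_apply hΦ.measurable (measurableSet_cyl σ), pow_zero, one_mul]

/-! ### Truth-table equivalence -/

/-- The least length of an initial segment of `ρ` on which `χ` holds, or `|ρ| + 1` if there is
none. -/
def firstIdx (χ : Str → Bool) (ρ : Str) : ℕ :=
  ((List.range (ρ.length + 1)).map fun k => χ (ρ.take k)).findIdx id

/-- Follow `φ` until `χ` holds, and copy the argument from then on. -/
def divert (χ : Str → Bool) (φ : Str → Str) (ρ : Str) : Str :=
  φ (ρ.take (firstIdx χ ρ)) ++ ρ.drop (firstIdx χ ρ)

theorem divert_of_least {χ : Str → Bool} (φ : Str → Str) {ρ : Str} {j : ℕ} (hj : j ≤ ρ.length)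
    (h : χ (ρ.take j) = true) (hlt : ∀ i < j, χ (ρ.take i) = false) :
    divert χ φ ρ = φ (ρ.take j) ++ ρ.drop j := by
  have : firstIdx χ ρ = j := by
    unfold firstIdx
    rw [List.findIdx_eq (by simp; omega)]
    simp only [List.getElem_map, List.getElem_range, id]
    exact ⟨h, hlt⟩
  rw [divert, this]

theorem divert_of_forall {χ : Str → Bool} (φ : Str → Str) {ρ : Str}
    (h : ∀ i ≤ ρ.length, χ (ρ.take i) = false) : divert χ φ ρ = φ ρ := by
  have : ρ.length + 1 ≤ firstIdx χ ρ := by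
    unfold firstIdx
    rw [List.findIdx_eq_length_of_false, List.length_map, List.length_range]
    intro b hb
    obtain ⟨i, hi, rfl⟩ := List.mem_map.1 hb
    exact h i (Nat.lt_succ_iff.1 (List.mem_range.1 hi))
  rw [divert, List.take_of_length_le (by omega), List.drop_of_length_le (by omega),
    List.append_nil]

theorem exists_least_or_forall (χ : Str → Bool) (ρ : Str) :
    (∃ j ≤ ρ.length, χ (ρ.take j) = true ∧ ∀ i < j, χ (ρ.take i) = false) ∨
      ∀ i ≤ ρ.length, χ (ρ.take i) = false := by
  by_cases h : ∃ j, j ≤ ρ.length ∧ χ (ρ.take j) = true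
  · classical
    have hs := Nat.find_spec h
    refine Or.inl ⟨Nat.find h, hs.1, hs.2, fun i hi => ?_⟩
    have := Nat.find_min h hi
    simpa [(hi.le.trans hs.1)] using this
  · push Not at h
    exact Or.inr fun i hi => by simpa using h i hi

theorem divert_mono {χ : Str → Bool} {φ : Str → Str}
    (hmono : ∀ σ τ : Str, σ <+: τ → φ σ <+: φ τ) {σ τ : Str} (h : σ <+: τ) :
    divert χ φ σ <+: divert χ φ τ := by
  have htake : ∀ i ≤ σ.length, σ.take i = τ.take i := fun i hi => by
    obtain ⟨t, rfl⟩ := h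
    rw [List.take_append_of_le_length hi]
  rcases exists_least_or_forall χ σ with ⟨j, hj, hχ, hlt⟩ | hσ
  · rw [divert_of_least φ hj hχ hlt, divert_of_least φ (hj.trans h.length_le)
      (by rwa [← htake j hj]) (fun i hi => by rw [← htake i (by omega)]; exact hlt i hi),
      htake j hj, List.prefix_append_right_inj]
    obtain ⟨t, rfl⟩ := h
    rw [List.drop_append_of_le_length hj]
    exact List.prefix_append _ _
  · rw [divert_of_forall φ hσ]
    rcases exists_least_or_forall χ τ with ⟨j, hj, hχ, hlt⟩ | hτ
    · rw [divert_of_least φ hj hχ hlt]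
      refine (hmono _ _ ?_).trans (List.prefix_append _ _)
      rw [List.prefix_take_iff]
      refine ⟨h, le_of_not_ge fun hle => ?_⟩
      have := hσ j hle
      rw [htake j hle, hχ] at this
      exact absurd this (by simp)
    · rw [divert_of_forall φ hτ]
      exact hmono _ _ h

theorem computableIn_divert {O : Set (ℕ →. ℕ)} {χ : Str → Bool} {φ : Str → Str}
    (hχ : ComputableIn O χ) (hφ : ComputableIn O φ) : ComputableIn O (divert χ φ) := by
  have h₁ : ComputableIn O fun l : List Bool => l.findIdx id :=
    (Primrec.list_findIdx (p := fun _ b => b) .id Primrec.snd.to₂).computableIn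
  have h₂ : ComputableIn O (firstIdx χ) :=
    ComputableIn.comp (g := fun ρ : Str => (List.range (ρ.length + 1)).map fun k => χ (ρ.take k))
      h₁ (by fun_prop)
  unfold divert
  fun_prop

instance : NullSingletonClass lebesgue := ⟨isContinuous_lebesgue⟩

/-- The point that extends `ρ` by the bits of `w` from position `l` on. -/
def extendBy (ρ : Str) (w : Cantor) (l : ℕ) : Cantor :=
  fun i => if h : i < ρ.length then ρ[i] else w (l + (i - ρ.length))

/-- A truth-table reduction of `x` to `R` can be replaced by one with countable fibres if `R` is
truth-table reducible to `x`. -/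
theorem TTEquivRel.exists_countable_fibres {z x R : Cantor} (h : TTEquivRel z x R) :
    ∃ Φ : Cantor → Cantor, RecursiveFunctional z Φ ∧ (∀ w, (Φ ⁻¹' {w}).Countable) ∧ Φ R = x := by
  obtain ⟨⟨Φ, ⟨φ, hcφ, hmφ, hφ⟩, hΦ⟩, ⟨Ψ, ⟨ψ, hcψ, hmψ, hψ⟩, hΨ⟩⟩ := h
  -- The diversion is triggered when `Ψ ∘ Φ` is seen to differ from the identity on the argument.
  let χ : Str → Bool := fun ρ =>
    !decide ((ψ (φ ρ)).take ρ.length = ρ.take (ψ (φ ρ)).length)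
  have hχ : ∀ ρ, χ ρ = false ↔ Compat (ψ (φ ρ)) ρ := fun ρ => by
    simp [χ, compat_iff_take]
  have hχc : ComputableIn {oracle z} χ := by
    unfold χ
    fun_prop
  have hΨmem : ∀ (w : Cantor) (σ : Str), w ∈ cyl σ → Ψ w ∈ cyl (ψ σ) := fun w σ hw => by
    have := (hψ w).1 σ.length
    rwa [mem_cyl.1 hw] at this
  have hnone : ∀ y : Cantor, (∀ i, χ (restr y i) = false) → ∀ k,
      divert χ φ (restr y k) = φ (restr y k) := fun y hy k => by
    refine divert_of_forall φ fun i hi => ?_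
    rw [length_restr] at hi
    rw [take_restr y hi]
    exact hy i
  have hleast : ∀ (y : Cantor) j, χ (restr y j) = true → (∀ i < j, χ (restr y i) = false) →
      ∀ k, j ≤ k → divert χ φ (restr y k) = φ (restr y j) ++ (restr y k).drop j :=
    fun y j hj hlt k hk => by
      rw [divert_of_least φ (j := j) (by simpa using hk) (by rwa [take_restr y hk]) fun i hi => by
        rw [take_restr y (by omega)]; exact hlt i hi, take_restr y hk]
  have hcases : ∀ y : Cantor, (∀ i, χ (restr y i) = false) ∨
      ∃ j, χ (restr y j) = true ∧ ∀ i < j, χ (restr y i) = false := fun y => by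
    by_cases hy : ∃ j, χ (restr y j) = true
    · classical
      exact Or.inr ⟨Nat.find hy, Nat.find_spec hy, fun i hi => by simpa using Nat.find_min hy hi⟩
    · exact Or.inl fun i => by simpa using not_exists.1 hy i
  have hlen : ∀ (y : Cantor) n, ∃ k, n ≤ (divert χ φ (restr y k)).length := by
    intro y n
    rcases hcases y with hy | ⟨j, hj, hlt⟩
    · obtain ⟨k, hk⟩ := (hφ y).2 n
      exact ⟨k, by rwa [hnone y hy]⟩
    · refine ⟨j + n, ?_⟩
      rw [hleast y j hj hlt _ (Nat.le_add_right _ _)]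
      simp
  obtain ⟨Φ', hΦ'⟩ := exists_functional (fun σ τ => divert_mono hmφ) hlen
  refine ⟨Φ', ⟨divert χ φ, computableIn_divert hχc hcφ, fun σ τ => divert_mono hmφ,
    fun y => ⟨hΦ' y, hlen y⟩⟩, fun w => ?_, ?_⟩
  -- A point of the fibre that is never diverted equals `Ψ w`. One diverted after the prefix `ρ` is
  -- recovered from `ρ` and `w`, since the rest of it was copied; there are only countably many `ρ`.
  · refine Set.Countable.mono (s₂ := {Ψ w} ∪ Set.range fun ρ : Str => extendBy ρ w (φ ρ).length)
      ?_ ((Set.countable_singleton _).union (Set.countable_range _))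
    intro y hy
    have hyw : Φ' y = w := hy
    rcases hcases y with hg | ⟨j, hj, hlt⟩
    · refine Or.inl (Set.mem_singleton_iff.2 (funext fun n => ?_))
      obtain ⟨m, hm⟩ := (hψ w).2 (n + 1)
      obtain ⟨k, hk⟩ := (hφ y).2 m
      have hk' : m ≤ (φ (restr y (n + 1 + k))).length :=
        hk.trans (hmφ _ _ (restr_prefix y (Nat.le_add_left _ _))).length_le
      have hw : w ∈ cyl (φ (restr y (n + 1 + k))) := by
        rw [← hyw, ← hnone y hg]
        exact hΦ' y _
      have hl := (hmψ _ _ (prefix_of_mem_cyl (mem_cyl_restr w m) hw (by simpa using hk'))).length_le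
      exact (eq_of_compat ((hχ _).1 (hg (n + 1 + k))) (hΨmem w _ hw) (mem_cyl_restr y _)
        (by omega) (by simp; omega)).symm
    · refine Or.inr ⟨restr y j, funext fun i => ?_⟩
      simp only [extendBy, length_restr]
      split_ifs with hi
      · exact getElem_restr y j i _
      · have h₁ := hΦ' y (i + 1)
        rw [hleast y j hj hlt _ (by omega), hyw] at h₁
        rw [mem_cyl_iff_getElem.1 h₁ _ (by simp; omega),
          List.getElem_append_right (by omega), List.getElem_drop, getElem_restr]
        congr 1
        omega
  -- `Ψ (Φ R) = R`, so the diversion never occurs along `R`.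
  · have hg : ∀ i, χ (restr R i) = false := fun i => by
      rw [hχ]
      refine compat_of_mem_cyl (y := R) ?_ (mem_cyl_restr R i)
      have := hΨmem x (φ (restr R i)) (by rw [← hΦ]; exact (hφ R).1 i)
      rwa [hΨ] at this
    funext n
    obtain ⟨k, hk⟩ := (hφ R).2 (n + 1)
    have h₁ := hΦ' R k
    rw [hnone R hg] at h₁
    have h₂ := (hφ R).1 k
    rw [hΦ] at h₂
    rw [mem_cyl_iff_getElem.1 h₁ n hk, mem_cyl_iff_getElem.1 h₂ n hk]

/-! ### Dyadic cuts of Cantor space -/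

/-- The number with binary expansion `σ`. -/
def binVal (σ : Str) : ℕ := σ.foldl (fun v b => 2 * v + b.toNat) 0

/-- The number whose binary expansion is formed by the first `n` bits of `y`. -/
def initVal (y : Cantor) (n : ℕ) : ℕ := binVal (restr y n)

@[simp]
theorem initVal_zero (y : Cantor) : initVal y 0 = 0 := rfl

theorem initVal_succ (y : Cantor) (n : ℕ) :
    initVal y (n + 1) = 2 * initVal y n + (y n).toNat := by
  simp [initVal, restr_succ, binVal]

theorem initVal_add_lower (y : Cantor) (n j : ℕ) : 2 ^ j * initVal y n ≤ initVal y (n + j) := by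
  induction j with
  | zero => simp
  | succ j ih => rw [← add_assoc, initVal_succ, pow_succ]; nlinarith

theorem initVal_add_upper (y : Cantor) (n j : ℕ) :
    initVal y (n + j) < 2 ^ j * (initVal y n + 1) := by
  induction j with
  | zero => simp
  | succ j ih =>
    have := Bool.toNat_le (y (n + j))
    rw [← add_assoc, initVal_succ, pow_succ]
    nlinarith

theorem initVal_lt (y : Cantor) (n : ℕ) : initVal y n < 2 ^ n := by
  simpa using initVal_add_upper y 0 n

theorem restr_eq_of_initVal_eq {y w : Cantor} {n : ℕ} (h : initVal y n = initVal w n) :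
    restr y n = restr w n := by
  induction n with
  | zero => rfl
  | succ n ih =>
    rw [initVal_succ, initVal_succ] at h
    have h₁ := Bool.toNat_le (y n)
    have h₂ := Bool.toNat_le (w n)
    have h₃ : (y n).toNat = (w n).toNat := by omega
    have h₄ : y n = w n := by revert h₃; cases y n <;> cases w n <;> simp
    rw [restr_succ, restr_succ, ih (by omega), h₄]

theorem binVal_eq_initVal (σ : Str) : binVal σ = initVal (padZero σ) σ.length := by
  rw [initVal, restr_padZero]

theorem mem_cyl_iff_initVal {y : Cantor} {σ : Str} :
    y ∈ cyl σ ↔ initVal y σ.length = binVal σ := by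
  rw [mem_cyl]
  constructor
  · intro h; rw [initVal, h]
  · intro h
    rw [binVal_eq_initVal] at h
    rw [restr_eq_of_initVal_eq h, restr_padZero]

theorem computableIn_binVal {O : Set (ℕ →. ℕ)} : ComputableIn O binVal :=
  ComputableIn.list_foldl (by fun_prop) (by fun_prop) (by fun_prop)

/-- The dyadic rational `m / 2 ^ k` given by a pair `(m, k)`. -/
noncomputable def dval (q : ℕ × ℕ) : ℝ := q.1 / 2 ^ q.2

theorem dval_nonneg (q : ℕ × ℕ) : 0 ≤ dval q := by unfold dval; positivity

theorem dval_le_iff {q r : ℕ × ℕ} : dval q ≤ dval r ↔ q.1 * 2 ^ r.2 ≤ r.1 * 2 ^ q.2 := by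
  unfold dval
  rw [div_le_div_iff₀ (by positivity) (by positivity)]
  exact_mod_cast Iff.rfl

theorem dval_lt_iff {q r : ℕ × ℕ} : dval q < dval r ↔ q.1 * 2 ^ r.2 < r.1 * 2 ^ q.2 := by
  rw [← not_le, dval_le_iff, not_le]

theorem dval_eq_iff {q r : ℕ × ℕ} : dval q = dval r ↔ q.1 * 2 ^ r.2 = r.1 * 2 ^ q.2 := by
  rw [le_antisymm_iff, le_antisymm_iff, dval_le_iff, dval_le_iff]

theorem dval_lt_one_iff {q : ℕ × ℕ} : dval q < 1 ↔ q.1 < 2 ^ q.2 := by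
  unfold dval
  rw [div_lt_one (by positivity)]
  exact_mod_cast Iff.rfl

theorem exists_dval_btwn {l u : ℝ} (hl : 0 ≤ l) (h : l < u) : ∃ q, l < dval q ∧ dval q < u := by
  obtain ⟨k, hk⟩ := exists_pow_lt_of_lt_one (sub_pos.2 h) (by norm_num : (1 / 2 : ℝ) < 1)
  refine ⟨(⌊l * 2 ^ k⌋₊ + 1, k), ?_⟩
  have h2 : (0 : ℝ) < 2 ^ k := by positivity
  unfold dval
  rw [lt_div_iff₀ h2, div_lt_iff₀ h2]
  push_cast
  refine ⟨Nat.lt_floor_add_one _, ?_⟩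
  have h₁ := Nat.floor_le (show 0 ≤ l * 2 ^ k by positivity)
  have h₂ : 1 < (u - l) * 2 ^ k := by
    rw [div_pow, one_pow, div_lt_iff₀ h2] at hk
    exact hk
  nlinarith

/-- The point `y`, regarded as a real number between `0` and `1`, lies above the cut at `q`. -/
def Above (q : ℕ × ℕ) (y : Cantor) : Prop := q.1 ≤ initVal y q.2

theorem above_iff_scale {m k : ℕ} {y : Cantor} (j : ℕ) :
    Above (m, k) y ↔ Above (m * 2 ^ j, k + j) y := by
  have h₁ := initVal_add_lower y k j
  have h₂ := initVal_add_upper y k j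
  simp only [Above]
  constructor
  · intro h
    calc m * 2 ^ j ≤ initVal y k * 2 ^ j := Nat.mul_le_mul_right _ h
      _ ≤ _ := by rwa [mul_comm]
  · intro h
    have : 2 ^ j * m < 2 ^ j * (initVal y k + 1) := by rw [mul_comm]; omega
    have := Nat.lt_of_mul_lt_mul_left this
    omega

theorem Above.anti {q r : ℕ × ℕ} {y : Cantor} (h : Above r y) (hle : dval q ≤ dval r) :
    Above q y := by
  obtain ⟨m, k⟩ := q
  obtain ⟨m', k'⟩ := r
  rw [above_iff_scale k'] 
  rw [above_iff_scale k, add_comm] at h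
  rw [dval_le_iff] at hle
  exact hle.trans h

theorem above_congr {q r : ℕ × ℕ} {y : Cantor} (h : dval q = dval r) : Above q y ↔ Above r y :=
  ⟨fun hq => hq.anti h.ge, fun hr => hr.anti h.le⟩

theorem not_above_of_one_le {q : ℕ × ℕ} {y : Cantor} (h : 1 ≤ dval q) : ¬ Above q y := by
  rw [← not_lt, dval_lt_one_iff, not_lt] at h
  exact not_le.2 ((initVal_lt y q.2).trans_le h)

theorem initVal_mono {y w : Cantor} (h : toLex y < toLex w) (n : ℕ) :
    initVal y n ≤ initVal w n := by
  obtain ⟨i, heq, hlt⟩ := h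
  have heq' : ∀ j ≤ i, initVal y j = initVal w j := by
    intro j hj
    induction j with
    | zero => rfl
    | succ j ih =>
      have : y j = w j := heq j hj
      rw [initVal_succ, initVal_succ, ih (by omega), this]
  rcases le_or_gt n i with hn | hn
  · exact (heq' n hn).le
  · obtain ⟨j, rfl⟩ := Nat.exists_eq_add_of_lt hn
    have hb : y i = false ∧ w i = true := by
      have : y i < w i := hlt
      revert this
      cases y i <;> cases w i <;> simp
    have h₁ := initVal_add_upper y (i + 1) j
    have h₂ := initVal_add_lower w (i + 1) j
    rw [initVal_succ, heq' i le_rfl, hb.1] at h₁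
    rw [initVal_succ, hb.2] at h₂
    rw [show i + j + 1 = i + 1 + j by omega]
    simp only [Bool.toNat_false, Bool.toNat_true, add_zero] at h₁ h₂
    omega

/-- If no cut separates the points, their initial segments have equal values at every level, so the
points coincide. -/
theorem lex_lt_iff {y w : Cantor} : toLex y < toLex w ↔ ∃ q, Above q w ∧ ¬ Above q y := by
  constructor
  · intro h
    by_contra hne
    push Not at hne
    have : y = w := eq_of_restr_eq fun n => ⟨n, le_rfl, restr_eq_of_initVal_eq
      (le_antisymm (initVal_mono h n) (hne (initVal w n, n) le_rfl))⟩
    exact absurd h (by rw [this]; exact lt_irrefl _)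
  · rintro ⟨q, hw, hy⟩
    by_contra hlt
    rcases (not_lt.1 hlt).lt_or_eq with h | h
    · exact hy (le_trans hw (initVal_mono h q.2))
    · rw [toLex_inj.1 h] at hw
      exact hy hw

theorem eq_of_above_iff {y w : Cantor} (h : ∀ q, Above q y ↔ Above q w) : y = w := by
  refine eq_of_restr_eq fun n => ⟨n, le_rfl, restr_eq_of_initVal_eq (le_antisymm ?_ ?_)⟩
  · exact (h (initVal y n, n)).1 le_rfl
  · exact (h (initVal w n, n)).2 le_rfl

/-- Every Dedekind cut of the dyadic rationals in `[0, 1)` is realised in Cantor space. -/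
theorem exists_above_iff {A : ℕ × ℕ → Prop} (hA : ∀ q r, dval q ≤ dval r → A r → A q)
    (h0 : A (0, 0)) (h1 : ¬ A (1, 0)) : ∃ w : Cantor, ∀ q, Above q w ↔ A q := by
  classical
  -- Binary search for the cut: `v n` is the largest numerator `m` with `A (m, n)`.
  let v : ℕ → ℕ := fun n => Nat.rec 0 (fun n v => 2 * v + (decide (A (2 * v + 1, n + 1))).toNat) n
  have hv : ∀ n, v (n + 1) = 2 * v n + (decide (A (2 * v n + 1, n + 1))).toNat := fun n => rfl
  let w : Cantor := fun n => decide (A (2 * v n + 1, n + 1))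
  have hw : ∀ n, initVal w n = v n := by
    intro n
    induction n with
    | zero => rfl
    | succ n ih => rw [initVal_succ, ih, hv]
  refine ⟨w, fun ⟨m, n⟩ => ?_⟩
  simp only [Above, hw]
  induction n generalizing m with
  | zero =>
    constructor
    · intro h
      obtain rfl : m = 0 := Nat.le_zero.1 h
      exact h0
    · intro h
      by_contra hm
      refine h1 (hA _ (m, 0) ?_ h)
      rw [dval_le_iff]
      have : v 0 < m := not_le.1 hm
      simp only [pow_zero, mul_one]
      omega
  | succ n ih =>
    have heven : ∀ m, A (2 * m, n + 1) ↔ m ≤ v n := fun m => by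
      have : dval (2 * m, n + 1) = dval (m, n) := by rw [dval_eq_iff]; simp only; ring
      rw [ih]
      exact ⟨hA _ _ this.ge, hA _ _ this.le⟩
    have hmono : ∀ {m m' : ℕ}, m ≤ m' → A (m', n + 1) → A (m, n + 1) := fun h =>
      hA _ _ (by rw [dval_le_iff]; exact Nat.mul_le_mul_right _ h)
    rw [hv]
    obtain ⟨m', rfl | rfl⟩ := Nat.even_or_odd' m
    · rw [heven]
      by_cases hb : A (2 * v n + 1, n + 1)
      · simp only [hb, decide_true, Bool.toNat_true]
        omega
      · simp [hb]
    · rcases lt_trichotomy m' (v n) with h | rfl | h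
      · have : A (2 * m' + 1, n + 1) := hmono (by omega) ((heven (v n)).2 le_rfl)
        simp only [this, iff_true]
        omega
      · by_cases hb : A (2 * v n + 1, n + 1) <;> simp [hb]
      · have : ¬ A (2 * m' + 1, n + 1) := fun h' => by
          have := (heven m').1 (hmono (by omega) h')
          omega
        simp only [this, iff_false, not_le]
        have := Bool.toNat_le (decide (A (2 * v n + 1, n + 1)))
        omega

/-! ### Distribution functions -/

theorem measurableSet_above (q : ℕ × ℕ) : MeasurableSet {y | Above q y} := by
  have : {y | Above q y} = ⋃ ρ ∈ {ρ : Str | ρ.length = q.2 ∧ q.1 ≤ binVal ρ}, cyl ρ := by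
    ext y
    simp only [Set.mem_ofPred_eq, Set.mem_iUnion, exists_prop]
    constructor
    · exact fun h => ⟨restr y q.2, ⟨by simp, h⟩, mem_cyl_restr y _⟩
    · rintro ⟨ρ, ⟨h₁, h₂⟩, h₃⟩
      rw [Above, ← h₁, mem_cyl_iff_initVal.1 h₃]
      exact h₂
  rw [this]
  exact MeasurableSet.biUnion (Set.to_countable _) fun ρ _ => measurableSet_cyl ρ

/-- The distribution function of `μ` at a dyadic rational. -/
noncomputable def cdf (μ : Measure Cantor) (q : ℕ × ℕ) : ℝ := μ.real {y | ¬ Above q y}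

theorem measurableSet_not_above (q : ℕ × ℕ) : MeasurableSet {y | ¬ Above q y} :=
  (measurableSet_above q).compl

theorem cdf_mono (μ : Measure Cantor) [IsProbabilityMeasure μ] {q r : ℕ × ℕ}
    (h : dval q ≤ dval r) : cdf μ q ≤ cdf μ r :=
  measureReal_mono fun _ hy hr => hy (hr.anti h)

theorem cdf_congr (μ : Measure Cantor) {q r : ℕ × ℕ} (h : dval q = dval r) :
    cdf μ q = cdf μ r := by
  simp only [cdf, above_congr h]

theorem cdf_zero (μ : Measure Cantor) : cdf μ (0, 0) = 0 := by simp [cdf, Above]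

theorem cdf_one (μ : Measure Cantor) [IsProbabilityMeasure μ] : cdf μ (1, 0) = 1 := by
  simp [cdf, Above]

theorem measureReal_between (μ : Measure Cantor) [IsProbabilityMeasure μ] {q r : ℕ × ℕ}
    (h : dval q ≤ dval r) : μ.real {y | Above q y ∧ ¬ Above r y} = cdf μ r - cdf μ q := by
  have hsub : {y | ¬ Above q y} ⊆ {y | ¬ Above r y} := fun y hy hr => hy (hr.anti h)
  rw [cdf, cdf, ← measureReal_sdiff hsub (measurableSet_not_above q)]
  congr 1
  ext y
  simp [and_comm]

/-- The cylinders around a point shrink to a null singleton, so their measures tend to 0; König's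
lemma makes this uniform. -/
theorem exists_cyl_lt {μ : Measure Cantor} [IsProbabilityMeasure μ] (hμ : IsContinuous μ) {ε : ℝ}
    (hε : 0 < ε) : ∃ k, ∀ σ : Str, k ≤ σ.length → μ.real (cyl σ) < ε := by
  refine exists_level (fun σ τ h hσ => (measureReal_mono (cyl_anti h)).trans_lt hσ) fun y => ?_
  have hanti : Antitone fun k => cyl (restr y k) := fun j k h => cyl_anti (restr_prefix y h)
  have hinter : ⋂ k, cyl (restr y k) = {y} := by
    ext w
    simp only [Set.mem_iInter, mem_cyl_restr_iff, Set.mem_singleton_iff]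
    exact ⟨fun h => eq_of_restr_eq fun n => ⟨n, le_rfl, h n⟩, fun h n => by rw [h]⟩
  have ht := tendsto_measure_iInter_atTop (μ := μ)
    (fun k => (measurableSet_cyl (restr y k)).nullMeasurableSet) hanti ⟨0, measure_ne_top _ _⟩
  rw [hinter, hμ y] at ht
  have ht' := (ENNReal.tendsto_toReal ENNReal.zero_ne_top).comp ht
  exact (ht'.eventually (gt_mem_nhds (by simpa using hε))).exists

theorem exists_cdf_sub_lt {μ : Measure Cantor} [IsProbabilityMeasure μ] (hμ : IsContinuous μ)
    {ε : ℝ} (hε : 0 < ε) : ∃ K, ∀ k, K ≤ k → ∀ m, cdf μ (m + 1, k) - cdf μ (m, k) < ε := by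
  obtain ⟨K, hK⟩ := exists_cyl_lt hμ hε
  refine ⟨K, fun k hk m => ?_⟩
  have hle : dval (m, k) ≤ dval (m + 1, k) :=
    dval_le_iff.2 (Nat.mul_le_mul_right _ (Nat.le_succ m))
  rw [← measureReal_between μ hle]
  -- Points between two adjacent cuts of level `k` share their first `k` bits. The set is empty when
  -- `m` is at least `2 ^ k`.
  rcases Set.eq_empty_or_nonempty {y | Above (m, k) y ∧ ¬ Above (m + 1, k) y} with h | ⟨y, hy⟩
  · rw [h, measureReal_empty]; exact hε
  · refine (measureReal_mono (s₂ := cyl (restr y k)) fun w hw => ?_).trans_lt (hK _ (by simpa))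
    rw [mem_cyl_restr_iff]
    simp only [Above, Set.mem_ofPred_eq] at hw hy
    exact restr_eq_of_initVal_eq (by omega)

theorem cdf_eq_sum (μ : Measure Cantor) [IsProbabilityMeasure μ] (m k : ℕ) :
    cdf μ (m, k) = ∑ s : Fin k → Bool with binVal (List.ofFn s) < m, μ.real (cyl (List.ofFn s)) := by
  rw [cdf, ← measureReal_biUnion_finset]
  · congr 1
    ext y
    simp only [Above, Set.mem_ofPred_eq, not_le, Finset.mem_filter, Finset.mem_univ, true_and,
      Set.mem_iUnion, exists_prop]
    constructor
    · intro h
      have : List.ofFn (fun i : Fin k => y i) = restr y k :=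
        List.ext_getElem (by simp) fun i h₁ h₂ => by simp [getElem_restr]
      exact ⟨fun i => y i, by rwa [this], by rw [this]; exact mem_cyl_restr y k⟩
    · rintro ⟨s, h₁, h₂⟩
      rw [mem_cyl_iff_initVal, List.length_ofFn] at h₂
      rwa [h₂]
  · intro s _ t _ hst
    exact disjoint_cyl (by simp) fun h => hst (List.ofFn_injective h)
  · exact fun s _ => measurableSet_cyl _

theorem abs_cdf_sub_cdf_le (μ ν : Measure Cantor) [IsProbabilityMeasure μ]
    [IsProbabilityMeasure ν] (m k : ℕ) : |cdf μ (m, k) - cdf ν (m, k)| ≤ levelDist μ ν k := by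
  rw [cdf_eq_sum, cdf_eq_sum, ← Finset.sum_sub_distrib]
  exact (Finset.abs_sum_le_sum_abs _ _).trans
    (Finset.sum_le_sum_of_subset_of_nonneg (Finset.filter_subset _ _) fun _ _ _ => abs_nonneg _)

/-- The total weight which a code gives to the points below the cut at `q`. -/
def Code.weightBelow (c : Code) (q : ℕ × ℕ) : ℕ :=
  (c.map fun e => bif Nat.blt (binVal (restr (padZero e.1) q.2)) q.1 then e.2 else 0).sum

theorem Code.cdf_measure (c : Code) (q : ℕ × ℕ) :
    cdf c.measure q = c.weightBelow q / c.total := by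
  rw [cdf, Measure.real, c.measure_apply (measurableSet_not_above q)
    (fun σ => Nat.blt (binVal (restr (padZero σ) q.2)) q.1)
    (by simp [Above, initVal])]
  rw [ENNReal.toReal_div, ENNReal.toReal_natCast, ENNReal.toReal_natCast]
  rfl

theorem Represents.abs_cdf_sub_le {μ : Measure Cantor} [IsProbabilityMeasure μ] {p : ℕ → Code}
    (hp : Represents p μ) (n : ℕ) (q : ℕ × ℕ) :
    |((p n).weightBelow q : ℝ) / (p n).total - cdf μ q| ≤ 2 ^ (q.2 + 2) / 2 ^ n := by
  obtain ⟨h₁, h₂⟩ := hp n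
  have := Code.isProbabilityMeasure h₁
  -- The metric sees only levels `n ≥ 1`, so the cut is moved up one level to include level 0.
  have heq : dval q = dval (2 * q.1, q.2 + 1) := by rw [dval_eq_iff]; simp only; ring
  rw [← Code.cdf_measure, cdf_congr _ heq, cdf_congr μ heq]
  exact (abs_cdf_sub_cdf_le _ _ _ _).trans (levelDist_le_of_measDist_le h₂ q.2)

/-! ### Partial isomorphisms of the dyadic rationals -/

/-- The two pairs of dyadic rationals have the same values. -/
def SameVal (p q : (ℕ × ℕ) × (ℕ × ℕ)) : Prop := dval p.1 = dval q.1 ∧ dval p.2 = dval q.2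

/-- Both components increase from `p` to `q`, the second one by more than half the measure of the
interval between the first ones. -/
def Steep (μ : Measure Cantor) (p q : (ℕ × ℕ) × (ℕ × ℕ)) : Prop :=
  dval p.1 < dval q.1 ∧ dval p.2 < dval q.2 ∧
    cdf μ q.1 - cdf μ p.1 < 2 * (dval q.2 - dval p.2)

/-- The pairs `p` and `q` may belong to the graph of the same increasing map. -/
def Fits (μ : Measure Cantor) (p q : (ℕ × ℕ) × (ℕ × ℕ)) : Prop :=
  SameVal p q ∨ Steep μ p q ∨ Steep μ q p

variable {μ : Measure Cantor} {p q r : (ℕ × ℕ) × (ℕ × ℕ)}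

theorem SameVal.symm (h : SameVal p q) : SameVal q p := ⟨h.1.symm, h.2.symm⟩

theorem Steep.trans (h : Steep μ p q) (h' : Steep μ q r) : Steep μ p r :=
  ⟨h.1.trans h'.1, h.2.1.trans h'.2.1, by linarith [h.2.2, h'.2.2]⟩

theorem SameVal.trans_steep (h : SameVal p q) (h' : Steep μ q r) : Steep μ p r := by
  rw [Steep, h.1, h.2, cdf_congr μ h.1]
  exact h'

theorem Steep.trans_sameVal (h : Steep μ p q) (h' : SameVal q r) : Steep μ p r := by
  rw [Steep, ← h'.1, ← h'.2, ← cdf_congr μ h'.1]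
  exact h

theorem Fits.refl (p : (ℕ × ℕ) × (ℕ × ℕ)) : Fits μ p p := Or.inl ⟨rfl, rfl⟩

theorem Fits.symm (h : Fits μ p q) : Fits μ q p := by
  rcases h with h | h | h
  · exact Or.inl h.symm
  · exact Or.inr (Or.inr h)
  · exact Or.inr (Or.inl h)

theorem Fits.steep_of_fst_lt (h : Fits μ p q) (hlt : dval p.1 < dval q.1) : Steep μ p q := by
  rcases h with h | h | h
  · exact absurd h.1 hlt.ne
  · exact h
  · exact absurd h.1 hlt.not_gt

theorem Fits.steep_of_snd_lt (h : Fits μ p q) (hlt : dval p.2 < dval q.2) : Steep μ p q := by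
  rcases h with h | h | h
  · exact absurd h.2 hlt.ne
  · exact h
  · exact absurd h.2.1 hlt.not_gt

theorem Fits.sameVal_of_fst_eq (h : Fits μ p q) (heq : dval p.1 = dval q.1) : SameVal p q := by
  rcases h with h | h | h
  · exact h
  · exact absurd heq h.1.ne
  · exact absurd heq h.1.ne'

theorem Fits.sameVal_of_snd_eq (h : Fits μ p q) (heq : dval p.2 = dval q.2) : SameVal p q := by
  rcases h with h | h | h
  · exact h
  · exact absurd heq h.2.1.ne
  · exact absurd heq h.2.1.ne'

theorem Fits.fst_le_of_snd_le (h : Fits μ p q) (hle : dval p.2 ≤ dval q.2) :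
    dval p.1 ≤ dval q.1 :=
  le_of_not_gt fun hlt => hle.not_gt (h.symm.steep_of_fst_lt hlt).2.1

theorem Fits.snd_le_of_fst_le (h : Fits μ p q) (hle : dval p.1 ≤ dval q.1) :
    dval p.2 ≤ dval q.2 :=
  le_of_not_gt fun hlt => hle.not_gt (h.symm.steep_of_snd_lt hlt).1

/-- The two bounds on `b` required by steepness on the left and on the right leave an open interval,
precisely because `p` and `q` are steep. -/
theorem Steep.exists_snd [IsProbabilityMeasure μ] (h : Steep μ p q) {a : ℕ × ℕ}
    (hpa : dval p.1 < dval a) (haq : dval a < dval q.1) :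
    ∃ b, Steep μ p (a, b) ∧ Steep μ (a, b) q := by
  have h₁ := cdf_mono μ hpa.le
  have h₂ := cdf_mono μ haq.le
  obtain ⟨-, -, h₃⟩ := h
  obtain ⟨b, hb₁, hb₂⟩ := exists_dval_btwn
    (l := dval p.2 + (cdf μ a - cdf μ p.1) / 2) (u := dval q.2 - (cdf μ q.1 - cdf μ a) / 2)
    (by linarith [dval_nonneg p.2]) (by linarith)
  refine ⟨b, ⟨hpa, ?_, ?_⟩, haq, ?_, ?_⟩ <;> simp only <;> linarith

/-- Steepness asks for `cdf μ a` strictly between `l` and `u`. Without atoms, the distribution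
function has arbitrarily small steps on fine grids and cannot jump over this window. -/
theorem Steep.exists_fst [IsProbabilityMeasure μ] (hμ : IsContinuous μ) (h : Steep μ p q)
    {b : ℕ × ℕ} (hpb : dval p.2 < dval b) (hbq : dval b < dval q.2) :
    ∃ a, Steep μ p (a, b) ∧ Steep μ (a, b) q := by
  classical
  obtain ⟨h₁, -, h₃⟩ := h
  set l := cdf μ q.1 - 2 * (dval q.2 - dval b) with hl
  set u := cdf μ p.1 + 2 * (dval b - dval p.2) with hu
  have hlu : l < u := by linarith
  have hlq : l < cdf μ q.1 := by linarith
  have hpu : cdf μ p.1 < u := by linarith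
  -- The steps must be smaller than the window `(l, u)`, and also than the gaps that keep `a` away
  -- from both endpoints.
  obtain ⟨K, hK⟩ := exists_cdf_sub_lt hμ
    (lt_min (sub_pos.2 hlu) (lt_min (sub_pos.2 hpu) (sub_pos.2 hlq)))
  -- Both endpoints lie on this grid with even numerators, so a grid point is strictly between them.
  set k := K + p.1.2 + q.1.2 + 1 with hk
  have hscale : ∀ (c : ℕ × ℕ) (j : ℕ), c.2 + j + 1 = k → dval (2 * (c.1 * 2 ^ j), k) = dval c := by
    intro c j hj
    rw [dval_eq_iff, ← hj]
    simp only
    ring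
  set m₁ := p.1.1 * 2 ^ (K + q.1.2)
  set m₂ := q.1.1 * 2 ^ (K + p.1.2)
  have hm₁ : dval (2 * m₁, k) = dval p.1 := hscale _ _ (by omega)
  have hm₂ : dval (2 * m₂, k) = dval q.1 := hscale _ _ (by omega)
  have hlt : m₁ < m₂ := by
    rw [← hm₁, ← hm₂, dval_lt_iff] at h₁
    have := Nat.lt_of_mul_lt_mul_right h₁
    omega
  have hmlt : ∀ {m m' : ℕ}, m < m' → dval (m, k) < dval (m', k) := fun h =>
    dval_lt_iff.2 (Nat.mul_lt_mul_of_pos_right h (by positivity))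
  -- The first grid point beyond the left endpoint whose value exceeds `l` is chosen.
  have hex : ∃ m, 2 * m₁ + 1 ≤ m ∧ l < cdf μ (m, k) :=
    ⟨2 * m₂, by omega, by rwa [cdf_congr μ hm₂]⟩
  set m := Nat.find hex with hm
  obtain ⟨hms₁, hms₂⟩ := Nat.find_spec hex
  rw [← hm] at hms₁ hms₂
  have hmle : m ≤ 2 * m₂ := Nat.find_min' hex ⟨by omega, by rwa [cdf_congr μ hm₂]⟩
  have hpred : cdf μ (m - 1, k) ≤ l ∨ m = 2 * m₁ + 1 := by
    by_contra hcon
    push Not at hcon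
    have := Nat.find_min hex (m := m - 1) (by omega)
    exact this ⟨by omega, hcon.1⟩
  have hstep := hK k (by omega) (m - 1)
  rw [Nat.sub_add_cancel (by omega), lt_min_iff, lt_min_iff] at hstep
  -- Otherwise a single step would rise from at most `l` to `cdf μ q.1`.
  have hmne : m ≠ 2 * m₂ := fun he => by
    rcases hpred with hp | hp
    · have := hstep.2.2
      rw [he, cdf_congr μ hm₂, ← he] at this
      linarith
    · omega
  have hmu : cdf μ (m, k) < u := by
    rcases hpred with hp | hp
    · linarith [hstep.1]
    · have h₅ := hstep.2.1
      have : cdf μ (m - 1, k) = cdf μ p.1 := by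
        rw [hp, Nat.add_sub_cancel]; exact cdf_congr μ hm₁
      linarith
  refine ⟨(m, k), ⟨?_, hpb, ?_⟩, ?_, hbq, ?_⟩
  · rw [← hm₁]; exact hmlt (by omega)
  · simp only; linarith
  · rw [← hm₂]; exact hmlt (by omega)
  · simp only; linarith

/-- Between two neighbouring pairs of a finite partial isomorphism there is room for a new one. -/
theorem exists_neighbours {L : List ((ℕ × ℕ) × (ℕ × ℕ))} {f : (ℕ × ℕ) × (ℕ × ℕ) → ℝ} {t : ℝ}
    (hlt : ∀ p ∈ L, ∀ q ∈ L, f p < f q → Steep μ p q)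
    (heq : ∀ p ∈ L, ∀ q ∈ L, f p = f q → SameVal p q)
    (hlo : ∃ p ∈ L, f p < t) (hhi : ∃ p ∈ L, t < f p) (hne : ∀ p ∈ L, f p ≠ t) :
    ∃ p₁ p₂, Steep μ p₁ p₂ ∧ f p₁ < t ∧ t < f p₂ ∧
      ∀ q, Steep μ p₁ q → Steep μ q p₂ → ∀ p ∈ L, Fits μ q p := by
  classical
  obtain ⟨p₁, hp₁, hmax⟩ := (L.toFinset.filter (f · < t)).exists_max_image f (by
    obtain ⟨p, hp, h⟩ := hlo
    exact ⟨p, by simp [hp, h]⟩)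
  obtain ⟨p₂, hp₂, hmin⟩ := (L.toFinset.filter (t < f ·)).exists_min_image f (by
    obtain ⟨p, hp, h⟩ := hhi
    exact ⟨p, by simp [hp, h]⟩)
  simp only [Finset.mem_filter, List.mem_toFinset] at hp₁ hp₂ hmax hmin
  refine ⟨p₁, p₂, hlt _ hp₁.1 _ hp₂.1 (hp₁.2.trans hp₂.2), hp₁.2, hp₂.2,
    fun q h₁ h₂ p hp => ?_⟩
  rcases lt_or_gt_of_ne (hne p hp) with h | h
  · refine Or.inr (Or.inr ?_)
    rcases (hmax p ⟨hp, h⟩).lt_or_eq with h' | h'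
    · exact (hlt _ hp _ hp₁.1 h').trans h₁
    · exact (heq _ hp _ hp₁.1 h').trans_steep h₁
  · refine Or.inr (Or.inl ?_)
    rcases (hmin p ⟨hp, h⟩).lt_or_eq with h' | h'
    · exact h₂.trans (hlt _ hp₂.1 _ hp h')
    · exact h₂.trans_sameVal (heq _ hp₂.1 _ hp h')

/-- The pair `(0, 0)`. -/
def botPair : (ℕ × ℕ) × (ℕ × ℕ) := ((0, 0), (0, 0))

/-- The pair `(1, 1)`. -/
def topPair : (ℕ × ℕ) × (ℕ × ℕ) := ((1, 0), (1, 0))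

theorem dval_zero : dval (0, 0) = 0 := by simp [dval]

theorem dval_one : dval (1, 0) = 1 := by simp [dval]

theorem steep_botPair_topPair [IsProbabilityMeasure μ] : Steep μ botPair topPair := by
  simp only [Steep, botPair, topPair, dval_zero, dval_one, cdf_zero, cdf_one]
  norm_num

/-- The forth step: a value that already occurs is answered by its old partner, any other by a new
pair between its two neighbours. -/
theorem exists_fits_fst [IsProbabilityMeasure μ] {L : List ((ℕ × ℕ) × (ℕ × ℕ))}
    (hL : ∀ p ∈ L, ∀ q ∈ L, Fits μ p q) (hbot : botPair ∈ L) (htop : topPair ∈ L) {a : ℕ × ℕ}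
    (ha : dval a < 1) : ∃ q, dval q.1 = dval a ∧ ∀ p ∈ L, Fits μ q p := by
  by_cases h : ∃ p ∈ L, dval p.1 = dval a
  · obtain ⟨p, hp, hpa⟩ := h
    exact ⟨p, hpa, hL p hp⟩
  · push Not at h
    obtain ⟨p₁, p₂, h₁₂, h₁, h₂, hfit⟩ := exists_neighbours (f := fun p => dval p.1) (t := dval a)
      (fun p hp q hq => (hL p hp q hq).steep_of_fst_lt)
      (fun p hp q hq => (hL p hp q hq).sameVal_of_fst_eq)
      ⟨_, hbot, lt_of_le_of_ne (by simpa [botPair, dval_zero] using dval_nonneg a) (h _ hbot)⟩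
      ⟨_, htop, by simpa [topPair, dval_one] using ha⟩ h
    obtain ⟨b, hb₁, hb₂⟩ := h₁₂.exists_snd h₁ h₂
    exact ⟨(a, b), rfl, hfit _ hb₁ hb₂⟩

/-- The back step, where the absence of atoms is used. -/
theorem exists_fits_snd [IsProbabilityMeasure μ] (hμ : IsContinuous μ)
    {L : List ((ℕ × ℕ) × (ℕ × ℕ))} (hL : ∀ p ∈ L, ∀ q ∈ L, Fits μ p q) (hbot : botPair ∈ L)
    (htop : topPair ∈ L) {b : ℕ × ℕ} (hb : dval b < 1) :
    ∃ q, dval q.2 = dval b ∧ ∀ p ∈ L, Fits μ q p := by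
  by_cases h : ∃ p ∈ L, dval p.2 = dval b
  · obtain ⟨p, hp, hpb⟩ := h
    exact ⟨p, hpb, hL p hp⟩
  · push Not at h
    obtain ⟨p₁, p₂, h₁₂, h₁, h₂, hfit⟩ := exists_neighbours (f := fun p => dval p.2) (t := dval b)
      (fun p hp q hq => (hL p hp q hq).steep_of_snd_lt)
      (fun p hp q hq => (hL p hp q hq).sameVal_of_snd_eq)
      ⟨_, hbot, lt_of_le_of_ne (by simpa [botPair, dval_zero] using dval_nonneg b) (h _ hbot)⟩
      ⟨_, htop, by simpa [topPair, dval_one] using hb⟩ h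
    obtain ⟨a, ha₁, ha₂⟩ := h₁₂.exists_fst hμ h₁ h₂
    exact ⟨(a, b), rfl, hfit _ ha₁ ha₂⟩

/-! ### The recursive back-and-forth construction -/

/-- Equality of dyadic rationals. -/
def sameDyadic (a b : ℕ × ℕ) : Bool := decide (a.1 * 2 ^ b.2 = b.1 * 2 ^ a.2)

/-- A test for `Steep` that uses an approximation `c` with error `2 ^ (-n)` to the measure. -/
def steepTest (c : Code) (n : ℕ) (p q : (ℕ × ℕ) × (ℕ × ℕ)) : Bool :=
  Nat.blt (p.1.1 * 2 ^ q.1.2) (q.1.1 * 2 ^ p.1.2) &&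
  (Nat.blt (p.2.1 * 2 ^ q.2.2) (q.2.1 * 2 ^ p.2.2) &&
  Nat.blt (c.weightBelow q.1 * (2 ^ n * 2 ^ p.2.2 * 2 ^ q.2.2)
      + (2 ^ (q.1.2 + 2) + 2 ^ (p.1.2 + 2)) * (c.total * 2 ^ p.2.2 * 2 ^ q.2.2)
      + 2 * p.2.1 * (c.total * 2 ^ n * 2 ^ q.2.2))
    (c.weightBelow p.1 * (2 ^ n * 2 ^ p.2.2 * 2 ^ q.2.2)
      + 2 * q.2.1 * (c.total * 2 ^ n * 2 ^ p.2.2)))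

/-- A test for `Fits` that uses an approximation `c` with error `2 ^ (-n)` to the measure. -/
def fitsTest (c : Code) (n : ℕ) (p q : (ℕ × ℕ) × (ℕ × ℕ)) : Bool :=
  (sameDyadic p.1 q.1 && sameDyadic p.2 q.2) || (steepTest c n p q || steepTest c n q p)

/-- The pair `q` answers the request number `k`: the even requests ask for a given first
component, the odd ones for a given second component. -/
def requestTest (k : ℕ) (q : (ℕ × ℕ) × (ℕ × ℕ)) : Bool :=
  -- Requests for values of at least 1 are void.
  Nat.ble (2 ^ (k / 2).unpair.2) (k / 2).unpair.1 ||
    bif decide (k % 2 = 0) then sameDyadic q.1 (k / 2).unpair else sameDyadic q.2 (k / 2).unpair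

theorem sameDyadic_iff {a b : ℕ × ℕ} : sameDyadic a b = true ↔ dval a = dval b := by
  rw [sameDyadic, decide_eq_true_iff, dval_eq_iff]

/-- The integer test is this inequality with denominators cleared. The two error terms count against
acceptance, so a positive answer is reliable. -/
theorem steepTest_iff {c : Code} (hc : 0 < c.total) {n : ℕ} {p q : (ℕ × ℕ) × (ℕ × ℕ)} :
    steepTest c n p q = true ↔ dval p.1 < dval q.1 ∧ dval p.2 < dval q.2 ∧
      (c.weightBelow q.1 : ℝ) / c.total + 2 ^ (q.1.2 + 2) / 2 ^ n + 2 ^ (p.1.2 + 2) / 2 ^ n +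
        2 * dval p.2 < c.weightBelow p.1 / c.total + 2 * dval q.2 := by
  simp only [steepTest, Bool.and_eq_true, Nat.blt_eq, ← dval_lt_iff]
  refine and_congr_right fun _ => and_congr_right fun _ => ?_
  have hT : (0 : ℝ) < c.total := by exact_mod_cast hc
  have hpos : (0 : ℝ) < c.total * 2 ^ n * 2 ^ p.2.2 * 2 ^ q.2.2 := by positivity
  rw [← mul_lt_mul_iff_left₀ hpos, ← Nat.cast_lt (α := ℝ)]
  push_cast
  unfold dval
  refine iff_of_eq (congrArg₂ _ ?_ ?_)
  · field_simp
    ring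
  · field_simp

theorem steepTest_sound {μ : Measure Cantor} [IsProbabilityMeasure μ] {c : ℕ → Code}
    (hc : Represents c μ) {n : ℕ} {p q : (ℕ × ℕ) × (ℕ × ℕ)} (h : steepTest (c n) n p q = true) :
    Steep μ p q := by
  obtain ⟨h₁, h₂, h₃⟩ := (steepTest_iff (hc n).1).1 h
  have h₄ := abs_le.1 (hc.abs_cdf_sub_le n p.1)
  have h₅ := abs_le.1 (hc.abs_cdf_sub_le n q.1)
  exact ⟨h₁, h₂, by linarith [h₄.2, h₅.1]⟩

theorem tendsto_const_div_two_pow (C : ℝ) :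
    Filter.Tendsto (fun n : ℕ => C / 2 ^ n) Filter.atTop (nhds 0) :=
  tendsto_const_nhds.div_atTop (tendsto_pow_atTop_atTop_of_one_lt (by norm_num))

/-- The inequality in `Steep` is strict, so it survives once the errors are small compared with the
gap. -/
theorem steepTest_complete {μ : Measure Cantor} [IsProbabilityMeasure μ] {c : ℕ → Code}
    (hc : Represents c μ) {p q : (ℕ × ℕ) × (ℕ × ℕ)} (h : Steep μ p q) :
    ∀ᶠ n in Filter.atTop, steepTest (c n) n p q = true := by
  obtain ⟨h₁, h₂, h₃⟩ := h
  have ht := ((tendsto_const_div_two_pow (2 ^ (q.1.2 + 2))).add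
    (tendsto_const_div_two_pow (2 ^ (p.1.2 + 2)))).eventually
    (gt_mem_nhds (show (0 : ℝ) + 0 <
      (2 * (dval q.2 - dval p.2) - (cdf μ q.1 - cdf μ p.1)) / 2 by linarith))
  filter_upwards [ht] with n hn
  rw [steepTest_iff (hc n).1]
  have h₄ := abs_le.1 (hc.abs_cdf_sub_le n p.1)
  have h₅ := abs_le.1 (hc.abs_cdf_sub_le n q.1)
  exact ⟨h₁, h₂, by linarith [h₄.1, h₅.2]⟩

theorem fitsTest_sound {μ : Measure Cantor} [IsProbabilityMeasure μ] {c : ℕ → Code}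
    (hc : Represents c μ) {n : ℕ} {p q : (ℕ × ℕ) × (ℕ × ℕ)} (h : fitsTest (c n) n p q = true) :
    Fits μ p q := by
  simp only [fitsTest, Bool.or_eq_true, Bool.and_eq_true, sameDyadic_iff] at h
  exact h.imp id (Or.imp (steepTest_sound hc) (steepTest_sound hc))

theorem fitsTest_complete {μ : Measure Cantor} [IsProbabilityMeasure μ] {c : ℕ → Code}
    (hc : Represents c μ) {p q : (ℕ × ℕ) × (ℕ × ℕ)} (h : Fits μ p q) :
    ∀ᶠ n in Filter.atTop, fitsTest (c n) n p q = true := by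
  simp only [fitsTest, Bool.or_eq_true, Bool.and_eq_true, sameDyadic_iff]
  rcases h with h | h | h
  · exact Filter.Eventually.of_forall fun n => Or.inl h
  · exact (steepTest_complete hc h).mono fun n hn => Or.inr (Or.inl hn)
  · exact (steepTest_complete hc h).mono fun n hn => Or.inr (Or.inr hn)

theorem computableIn_weightBelow {O : Set (ℕ →. ℕ)} :
    ComputableIn O fun x : Code × (ℕ × ℕ) => x.1.weightBelow x.2 := by
  have h₁ := computableIn_binVal (O := O)
  have h₂ : ComputableIn O fun x : (Code × (ℕ × ℕ)) × (Str × ℕ) =>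
      restr (padZero x.2.1) x.1.2.2 := by
    unfold restr padZero
    fun_prop
  have h₃ : ComputableIn O fun x : (Code × (ℕ × ℕ)) × (Str × ℕ) =>
      binVal (restr (padZero x.2.1) x.1.2.2) := ComputableIn.comp h₁ h₂
  unfold Code.weightBelow
  refine ComputableIn.list_sum (ComputableIn.list_map (by fun_prop) ?_)
  exact ComputableIn.cond (ComputableIn.nat_blt h₃ (by fun_prop)) (by fun_prop) (by fun_prop)

theorem computableIn_steepTest {O : Set (ℕ →. ℕ)} :
    ComputableIn O fun x : Code × ℕ × ((ℕ × ℕ) × (ℕ × ℕ)) × ((ℕ × ℕ) × (ℕ × ℕ)) =>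
      steepTest x.1 x.2.1 x.2.2.1 x.2.2.2 := by
  have h₁ : ComputableIn O
      fun x : Code × ℕ × ((ℕ × ℕ) × (ℕ × ℕ)) × ((ℕ × ℕ) × (ℕ × ℕ)) =>
      x.1.weightBelow x.2.2.1.1 :=
    ComputableIn.comp (g := fun x : Code × ℕ × ((ℕ × ℕ) × (ℕ × ℕ)) × ((ℕ × ℕ) × (ℕ × ℕ)) =>
      (x.1, x.2.2.1.1)) computableIn_weightBelow (by fun_prop)
  have h₂ : ComputableIn O
      fun x : Code × ℕ × ((ℕ × ℕ) × (ℕ × ℕ)) × ((ℕ × ℕ) × (ℕ × ℕ)) =>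
      x.1.weightBelow x.2.2.2.1 :=
    ComputableIn.comp (g := fun x : Code × ℕ × ((ℕ × ℕ) × (ℕ × ℕ)) × ((ℕ × ℕ) × (ℕ × ℕ)) =>
      (x.1, x.2.2.2.1)) computableIn_weightBelow (by fun_prop)
  have h₃ : ComputableIn O Code.total := by
    unfold Code.total
    fun_prop
  unfold steepTest
  refine ComputableIn.and (by fun_prop) (ComputableIn.and (by fun_prop) (ComputableIn.nat_blt
    (ComputableIn.nat_add (ComputableIn.nat_add (ComputableIn.nat_mul h₂ (by fun_prop))
      (by fun_prop)) (by fun_prop))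
    (ComputableIn.nat_add (ComputableIn.nat_mul h₁ (by fun_prop)) (by fun_prop))))

theorem computableIn_fitsTest {O : Set (ℕ →. ℕ)} :
    ComputableIn O fun x : Code × ℕ × ((ℕ × ℕ) × (ℕ × ℕ)) × ((ℕ × ℕ) × (ℕ × ℕ)) =>
      fitsTest x.1 x.2.1 x.2.2.1 x.2.2.2 := by
  have h₁ := computableIn_steepTest (O := O)
  have h₂ := ComputableIn.comp
    (g := fun x : Code × ℕ × ((ℕ × ℕ) × (ℕ × ℕ)) × ((ℕ × ℕ) × (ℕ × ℕ)) =>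
      (x.1, x.2.1, x.2.2.2, x.2.2.1)) h₁ (by fun_prop)
  unfold fitsTest
  exact ComputableIn.or (by unfold sameDyadic; fun_prop) (ComputableIn.or h₁ h₂)

theorem computableIn_requestTest {O : Set (ℕ →. ℕ)} :
    ComputableIn O fun x : ℕ × ((ℕ × ℕ) × (ℕ × ℕ)) => requestTest x.1 x.2 := by
  unfold requestTest sameDyadic
  fun_prop

/-- A recursive enumeration of the graph of an isomorphism of the dyadic rationals in `[0, 1]`
that stretches the measure by at least `1 / 2`. -/
theorem exists_matching {μ : Measure Cantor} [IsProbabilityMeasure μ] (hμ : IsContinuous μ)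
    {c : ℕ → Code} (hc : Represents c μ) {O : Set (ℕ →. ℕ)} (hcO : ComputableIn O c) :
    ∃ s : ℕ → (ℕ × ℕ) × (ℕ × ℕ), ComputableIn O s ∧
      (∀ i j, Fits μ (s i) (s j)) ∧ (∀ i, Fits μ (s i) botPair) ∧ (∀ i, Fits μ (s i) topPair) ∧
      ∀ k, requestTest k (s k) = true := by
  -- `Fits` can only be confirmed, not decided, so a candidate comes with the precision at which the
  -- tests accept it.
  let check : List (((ℕ × ℕ) × (ℕ × ℕ)) × ℕ) → ((ℕ × ℕ) × (ℕ × ℕ)) × ℕ → Bool := fun L t =>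
    requestTest L.length t.1 &&
      (botPair :: topPair :: L.map Prod.fst).all fun p => fitsTest (c t.2) t.2 t.1 p
  have hcheck : ComputableIn₂ O check := by
    have h₁ : ComputableIn O
        fun x : List (((ℕ × ℕ) × (ℕ × ℕ)) × ℕ) × (((ℕ × ℕ) × (ℕ × ℕ)) × ℕ) =>
          requestTest x.1.length x.2.1 :=
      ComputableIn.comp (f := fun x : ℕ × ((ℕ × ℕ) × (ℕ × ℕ)) => requestTest x.1 x.2)
        (g := fun x : List (((ℕ × ℕ) × (ℕ × ℕ)) × ℕ) × (((ℕ × ℕ) × (ℕ × ℕ)) × ℕ) =>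
          (x.1.length, x.2.1)) computableIn_requestTest (by fun_prop)
    have h₂ : ComputableIn O
        fun x : (List (((ℕ × ℕ) × (ℕ × ℕ)) × ℕ) × (((ℕ × ℕ) × (ℕ × ℕ)) × ℕ)) ×
          ((ℕ × ℕ) × (ℕ × ℕ)) => fitsTest (c x.1.2.2) x.1.2.2 x.1.2.1 x.2 :=
      ComputableIn.comp
        (f := fun x : Code × ℕ × ((ℕ × ℕ) × (ℕ × ℕ)) × ((ℕ × ℕ) × (ℕ × ℕ)) =>
          fitsTest x.1 x.2.1 x.2.2.1 x.2.2.2)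
        (g := fun x : (List (((ℕ × ℕ) × (ℕ × ℕ)) × ℕ) × (((ℕ × ℕ) × (ℕ × ℕ)) × ℕ)) ×
          ((ℕ × ℕ) × (ℕ × ℕ)) => (c x.1.2.2, x.1.2.2, x.1.2.1, x.2)) computableIn_fitsTest
        (by fun_prop)
    exact ComputableIn.and h₁ (ComputableIn.list_all (by fun_prop) h₂)
  let inv : List (((ℕ × ℕ) × (ℕ × ℕ)) × ℕ) → Prop := fun L =>
    ∀ p ∈ botPair :: topPair :: L.map Prod.fst, ∀ q ∈ botPair :: topPair :: L.map Prod.fst,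
      Fits μ p q
  have hsound : ∀ L t, check L t = true →
      ∀ p ∈ botPair :: topPair :: L.map Prod.fst, Fits μ t.1 p := fun L t h p hp => by
    simp only [check, Bool.and_eq_true, List.all_eq_true] at h
    exact fitsTest_sound hc (h.2 p hp)
  have h_nil : inv [] := by
    intro p hp q hq
    simp only [List.map_nil, List.mem_cons, List.not_mem_nil, or_false] at hp hq
    have h := steep_botPair_topPair (μ := μ)
    rcases hp with rfl | rfl <;> rcases hq with rfl | rfl
    · exact Fits.refl _
    · exact Or.inr (Or.inl h)
    · exact Or.inr (Or.inr h)
    · exact Fits.refl _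
  have h_ext : ∀ L, inv L → ∃ t, check L t = true := by
    intro L hL
    have hq : ∃ q, requestTest L.length q = true ∧
        ∀ p ∈ botPair :: topPair :: L.map Prod.fst, Fits μ q p := by
      by_cases hlt : dval (L.length / 2).unpair < 1
      · rcases Nat.mod_two_eq_zero_or_one L.length with h2 | h2
        · obtain ⟨q, hq, hfit⟩ := exists_fits_fst hL (by simp) (by simp) hlt
          exact ⟨q, by simp [requestTest, h2, sameDyadic_iff, hq], hfit⟩
        · obtain ⟨q, hq, hfit⟩ := exists_fits_snd hμ hL (by simp) (by simp) hlt
          exact ⟨q, by simp [requestTest, h2, sameDyadic_iff, hq], hfit⟩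
      · rw [dval_lt_one_iff, not_lt, ← Nat.ble_eq] at hlt
        exact ⟨botPair, by rw [requestTest, hlt, Bool.true_or], hL _ (by simp)⟩
    obtain ⟨q, hreq, hfit⟩ := hq
    -- Each of the finitely many tests succeeds from some precision on, so one precision serves them
    -- all.
    obtain ⟨n, hn⟩ := ((Filter.eventually_all_finite
      (List.finite_toSet (botPair :: topPair :: L.map Prod.fst))).2
      fun p hp => fitsTest_complete hc (hfit p hp)).exists
    refine ⟨(q, n), ?_⟩
    simp only [check, Bool.and_eq_true, List.all_eq_true]
    exact ⟨hreq, hn⟩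
  have h_app : ∀ L t, inv L → check L t = true → inv (L ++ [t]) := by
    intro L t hL ht p hp q hq
    have hnew := hsound L t ht
    have hsplit : ∀ p, p ∈ botPair :: topPair :: (L ++ [t]).map Prod.fst →
        p ∈ botPair :: topPair :: L.map Prod.fst ∨ p = t.1 := fun p hp => by
      simp only [List.map_append, List.map_cons, List.map_nil, List.mem_cons, List.mem_append,
        List.not_mem_nil, or_false] at hp ⊢
      tauto
    rcases hsplit p hp with hp | rfl <;> rcases hsplit q hq with hq | rfl
    · exact hL p hp q hq
    · exact (hnew p hp).symm
    · exact hnew q hq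
    · exact Fits.refl _
  obtain ⟨s, hs, hsinv⟩ := ComputableIn.exists_seq hcheck inv h_nil h_ext h_app
  have hmem : ∀ {i k}, i < k → (s i).1 ∈ ((List.range k).map s).map Prod.fst := fun {i k} h =>
    List.mem_map_of_mem (List.mem_map_of_mem (List.mem_range.2 h))
  refine ⟨fun k => (s k).1, by fun_prop, fun i j => ?_, fun i => ?_, fun i => ?_, fun k => ?_⟩
  · exact (hsinv (i + j + 1)).1 _ (List.mem_cons_of_mem _ (List.mem_cons_of_mem _
      (hmem (by omega)))) _ (List.mem_cons_of_mem _ (List.mem_cons_of_mem _ (hmem (by omega))))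
  · exact hsound _ _ (hsinv i).2 _ (by simp)
  · exact hsound _ _ (hsinv i).2 _ (by simp)
  · have := (hsinv k).2
    simp only [check, Bool.and_eq_true, List.length_map, List.length_range] at this
    exact this.1

/-! ### From moving cuts to the order isomorphism -/

theorem sum_map_ble_range (N v : ℕ) :
    ((List.range N).map fun m => (Nat.ble m v).toNat).sum = min N (v + 1) := by
  induction N with
  | zero => simp
  | succ N ih =>
    rw [List.range_succ, List.map_append, List.sum_append, ih]
    by_cases h : N ≤ v
    · have : Nat.ble N v = true := by rwa [Nat.ble_eq]
      simp only [List.map_cons, List.map_nil, List.sum_singleton, this, Bool.toNat_true]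
      omega
    · have : Nat.ble N v = false := by rwa [← Bool.not_eq_true, Nat.ble_eq]
      simp only [List.map_cons, List.map_nil, List.sum_singleton, this, Bool.toNat_false]
      omega

/-- A map that is given by moving cuts recursively is a recursive functional. -/
theorem RecursiveFunctional.of_above {z : Cantor} {Φ : Cantor → Cantor} {f : ℕ × ℕ → ℕ × ℕ}
    (hf : ComputableIn {oracle z} f) (hΦ : ∀ y q, Above q (Φ y) ↔ Above (f q) y) :
    RecursiveFunctional z Φ := by
  -- Bit `n` of the image is read off by comparing the argument with the cuts corresponding to all
  -- dyadics of level `n + 1`.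
  let cuts : ℕ → List (ℕ × ℕ) := fun n => (List.range (2 ^ (n + 1))).map fun m => f (m, n + 1)
  let D : ℕ → Str → Bool := fun n σ => (cuts n).all fun c => Nat.ble c.2 σ.length
  let S : ℕ → Str → ℕ := fun n σ =>
    ((cuts n).map fun c => (Nat.ble c.1 (binVal (σ.take c.2))).toNat).sum
  have hcuts : ComputableIn {oracle z} cuts := by
    unfold cuts
    fun_prop
  have hD : ∀ n σ, D n σ = true ↔ ∀ c ∈ cuts n, c.2 ≤ σ.length := fun n σ => by
    simp only [D, List.all_eq_true, Nat.ble_eq]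
  refine RecursiveFunctional.of_bits
    (fun n σ => bif D n σ then some (decide (S n σ % 2 = 0)) else none) ?_ ?_ ?_
  · have h₁ : ComputableIn {oracle z} fun p : ℕ × Str => D p.1 p.2 := by
      unfold D
      fun_prop
    have h₂ : ComputableIn {oracle z} fun p : ℕ × Str => S p.1 p.2 := by
      have h₃ := computableIn_binVal (O := {oracle z})
      unfold S
      fun_prop
    exact ComputableIn.cond h₁ (ComputableIn.option_some (ComputableIn.eq
      (ComputableIn.nat_mod h₂ (by fun_prop)) (by fun_prop))) (by fun_prop)
  · intro n σ τ b hστ hσ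
    rcases hd : D n σ with _ | _
    · simp [hd] at hσ
    · have hd' := (hD n σ).1 hd
      have hdτ : D n τ = true := (hD n τ).2 fun c hc => (hd' c hc).trans hστ.length_le
      have hS : S n τ = S n σ := by
        refine congrArg List.sum (List.map_congr_left fun c hc => ?_)
        obtain ⟨t, rfl⟩ := hστ
        rw [List.take_append_of_le_length (hd' c hc)]
      simpa [hd, hdτ, hS] using hσ
  · intro y n
    set k := ((cuts n).map Prod.snd).sum with hk
    have hle : ∀ c ∈ cuts n, c.2 ≤ k := fun c hc =>
      List.single_le_sum (by simp) _ (List.mem_map_of_mem hc)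
    have hd : D n (restr y k) = true := (hD _ _).2 fun c hc => by
      rw [length_restr]; exact hle c hc
    -- The number of cuts below the argument; the extra 1 is the cut at 0. Hence the last bit is 1
    -- exactly when the count is even.
    have hS : S n (restr y k) = initVal (Φ y) (n + 1) + 1 := by
      have : S n (restr y k) = ((List.range (2 ^ (n + 1))).map
          fun m => (Nat.ble m (initVal (Φ y) (n + 1))).toNat).sum := by
        simp only [S, cuts, List.map_map]
        refine congrArg List.sum (List.map_congr_left fun m hm => ?_)
        have hc : f (m, n + 1) ∈ cuts n := List.mem_map_of_mem hm
        simp only [Function.comp]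
        rw [take_restr y (hle _ hc)]
        congr 1
        rw [Bool.eq_iff_iff, Nat.ble_eq, Nat.ble_eq]
        exact (hΦ y (m, n + 1)).symm
      rw [this, sum_map_ble_range, min_eq_right]
      exact initVal_lt _ _
    refine ⟨k, ?_⟩
    simp only [hd, hS, cond_true, Option.some.injEq, initVal_succ]
    cases Φ y n
    · simp
    · simp
      omega

/-- For every recursive continuous measure there is a recursive order isomorphism of Cantor space
that maps it to a measure bounded by twice Lebesgue measure. -/
theorem exists_homeomorph {μ : Measure Cantor} [IsProbabilityMeasure μ] (hμ : IsContinuous μ)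
    {c : ℕ → Code} (hc : Represents c μ) {z : Cantor} (hcz : ComputableIn {oracle z} c) :
    ∃ Φ : Cantor ≃ₜ Cantor, RecursiveFunctional z Φ ∧ OrderPreserving Φ ∧
      ∀ σ, μ (Φ ⁻¹' cyl σ) ≤ 2 ^ 1 * lebesgue (cyl σ) := by
  obtain ⟨s, hs, hfit, hbot, htop, hreq⟩ := exists_matching hμ hc hcz
  -- `pre` and `post` look up the matched pair with given second or first component: odd requests
  -- concern second components, even ones first components. Values beyond the range are sent to the
  -- top.
  let pre : ℕ × ℕ → (ℕ × ℕ) × (ℕ × ℕ) := fun q =>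
    bif Nat.blt q.1 (2 ^ q.2) then s (2 * Nat.pair q.1 q.2 + 1) else topPair
  let post : ℕ × ℕ → (ℕ × ℕ) × (ℕ × ℕ) := fun q =>
    bif Nat.blt q.1 (2 ^ q.2) then s (2 * Nat.pair q.1 q.2) else topPair
  have hpre_lt : ∀ q, dval q < 1 → pre q = s (2 * Nat.pair q.1 q.2 + 1) := fun q hq => by
    rw [dval_lt_one_iff, ← Nat.blt_eq] at hq
    simp only [pre, hq, cond_true]
  have hpost_lt : ∀ q, dval q < 1 → post q = s (2 * Nat.pair q.1 q.2) := fun q hq => by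
    rw [dval_lt_one_iff, ← Nat.blt_eq] at hq
    simp only [post, hq, cond_true]
  have hpre_ge : ∀ q, 1 ≤ dval q → pre q = topPair := fun q hq => by
    rw [← not_lt, dval_lt_one_iff, ← Nat.blt_eq, Bool.not_eq_true] at hq
    simp only [pre, hq, cond_false]
  have hpost_ge : ∀ q, 1 ≤ dval q → post q = topPair := fun q hq => by
    rw [← not_lt, dval_lt_one_iff, ← Nat.blt_eq, Bool.not_eq_true] at hq
    simp only [post, hq, cond_false]
  have hpre_snd : ∀ q, dval q < 1 → dval (pre q).2 = dval q := fun q hq => by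
    have h := hreq (2 * Nat.pair q.1 q.2 + 1)
    have h₁ : (2 * Nat.pair q.1 q.2 + 1) / 2 = Nat.pair q.1 q.2 := by omega
    have h₂ : (2 * Nat.pair q.1 q.2 + 1) % 2 = 1 := by omega
    have h₃ : Nat.ble (2 ^ q.2) q.1 = false := by
      rw [← Bool.not_eq_true, Nat.ble_eq, not_le]; exact dval_lt_one_iff.1 hq
    simp only [requestTest, h₁, h₂, Nat.unpair_pair, h₃, Bool.false_or, one_ne_zero, decide_false,
      cond_false, sameDyadic_iff] at h
    rw [hpre_lt q hq, h]
  have hpost_fst : ∀ q, dval q < 1 → dval (post q).1 = dval q := fun q hq => by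
    have h := hreq (2 * Nat.pair q.1 q.2)
    have h₁ : (2 * Nat.pair q.1 q.2) / 2 = Nat.pair q.1 q.2 := by omega
    have h₂ : (2 * Nat.pair q.1 q.2) % 2 = 0 := by omega
    have h₃ : Nat.ble (2 ^ q.2) q.1 = false := by
      rw [← Bool.not_eq_true, Nat.ble_eq, not_le]; exact dval_lt_one_iff.1 hq
    simp only [requestTest, h₁, h₂, Nat.unpair_pair, h₃, Bool.false_or, decide_true,
      cond_true, sameDyadic_iff] at h
    rw [hpost_lt q hq, h]
  have hfitS : ∀ p ∈ insert topPair (Set.range s), ∀ q ∈ insert topPair (Set.range s),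
      Fits μ p q := by
    rintro p (rfl | ⟨i, rfl⟩) q (rfl | ⟨j, rfl⟩)
    · exact Fits.refl _
    · exact (htop j).symm
    · exact htop i
    · exact hfit i j
  have hpre_mem : ∀ q, pre q ∈ insert topPair (Set.range s) := fun q => by
    rcases lt_or_ge (dval q) 1 with h | h
    · rw [hpre_lt q h]; exact Or.inr ⟨_, rfl⟩
    · rw [hpre_ge q h]; exact Or.inl rfl
  have hpost_mem : ∀ q, post q ∈ insert topPair (Set.range s) := fun q => by
    rcases lt_or_ge (dval q) 1 with h | h
    · rw [hpost_lt q h]; exact Or.inr ⟨_, rfl⟩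
    · rw [hpost_ge q h]; exact Or.inl rfl
  have htop_mem : topPair ∈ insert topPair (Set.range s) := Or.inl rfl
  have htop₁ : dval topPair.1 = 1 := dval_one
  have htop₂ : dval topPair.2 = 1 := dval_one
  have hpre_val : ∀ q, dval (pre q).2 = min (dval q) 1 := fun q => by
    rcases lt_or_ge (dval q) 1 with h | h
    · rw [hpre_snd q h, min_eq_left h.le]
    · rw [hpre_ge q h, min_eq_right h, htop₂]
  have hpost_val : ∀ q, dval (post q).1 = min (dval q) 1 := fun q => by
    rcases lt_or_ge (dval q) 1 with h | h
    · rw [hpost_fst q h, min_eq_left h.le]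
    · rw [hpost_ge q h, min_eq_right h, htop₁]
  have h0 : dval (0, 0) < 1 := by rw [dval_zero]; exact one_pos
  have hΦ : ∀ y, ∃ w, ∀ q, Above q w ↔ Above (pre q).1 y := fun y => by
    refine exists_above_iff (A := fun q => Above (pre q).1 y) (fun q r hqr hr => hr.anti ?_) ?_ ?_
    · refine (hfitS _ (hpre_mem q) _ (hpre_mem r)).fst_le_of_snd_le ?_
      rw [hpre_val, hpre_val]
      exact min_le_min_right _ hqr
    · have h : SameVal (pre (0, 0)) botPair := by
        rw [hpre_lt _ h0]
        refine (hbot _).sameVal_of_snd_eq ?_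
        rw [← hpre_lt _ h0, hpre_snd _ h0]
        rfl
      refine (above_congr h.1).2 ?_
      simp [Above, botPair]
    · rw [hpre_ge (1, 0) dval_one.ge]
      exact not_above_of_one_le htop₁.ge
  have hΨ : ∀ w, ∃ y, ∀ q, Above q y ↔ Above (post q).2 w := fun w => by
    refine exists_above_iff (A := fun q => Above (post q).2 w) (fun q r hqr hr => hr.anti ?_) ?_ ?_
    · refine (hfitS _ (hpost_mem q) _ (hpost_mem r)).snd_le_of_fst_le ?_
      rw [hpost_val, hpost_val]
      exact min_le_min_right _ hqr
    · have h : SameVal (post (0, 0)) botPair := by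
        rw [hpost_lt _ h0]
        refine (hbot _).sameVal_of_fst_eq ?_
        rw [← hpost_lt _ h0, hpost_fst _ h0]
        rfl
      refine (above_congr h.2).2 ?_
      simp [Above, botPair]
    · rw [hpost_ge (1, 0) dval_one.ge]
      exact not_above_of_one_le htop₂.ge
  choose Φ hΦ using hΦ
  choose Ψ hΨ using hΨ
  have hrec : RecursiveFunctional z Φ := by
    refine RecursiveFunctional.of_above (f := fun q => (pre q).1) ?_ hΦ
    unfold pre
    fun_prop
  -- Pulling a cut back and then pushing it forward finds two matched pairs with the same first
  -- value, so their second values agree as well.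
  have hΦΨ : ∀ w, Φ (Ψ w) = w := fun w => eq_of_above_iff fun q => by
    rw [hΦ, hΨ]
    rcases lt_or_ge (dval q) 1 with h | h
    · have hlt : dval (pre q).1 < 1 := by
        rw [← htop₁]
        refine ((hfitS _ (hpre_mem q) _ htop_mem).steep_of_snd_lt ?_).1
        rwa [hpre_snd q h, htop₂]
      have hsame := (hfitS _ (hpost_mem (pre q).1) _ (hpre_mem q)).sameVal_of_fst_eq
        (hpost_fst _ hlt)
      exact above_congr (hsame.2.trans (hpre_snd q h))
    · rw [hpre_ge q h, hpost_ge _ htop₁.ge]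
      exact iff_of_false (not_above_of_one_le htop₂.ge) (not_above_of_one_le h)
  have hord : OrderPreserving Φ := by
    intro y y' hyy'
    obtain ⟨r, hr', hr⟩ := lex_lt_iff.1 hyy'
    have hr1 : dval r < 1 := lt_of_not_ge fun h => not_above_of_one_le h hr'
    have hq1 : dval (post r).2 < 1 := by
      rw [← htop₂]
      refine ((hfitS _ (hpost_mem r) _ htop_mem).steep_of_fst_lt ?_).2.1
      rwa [hpost_fst r hr1, htop₁]
    have hsame := (hfitS _ (hpre_mem (post r).2) _ (hpost_mem r)).sameVal_of_snd_eq
      (hpre_snd _ hq1)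
    have hval : dval (pre (post r).2).1 = dval r := hsame.1.trans (hpost_fst r hr1)
    -- The image of a cut separating `y` and `y'` separates their images.
    refine lex_lt_iff.2 ⟨(post r).2, ?_, ?_⟩
    · rw [hΦ, above_congr hval]; exact hr'
    · rw [hΦ, above_congr hval]; exact hr
  have hinj : Function.Injective Φ := fun y y' h => by
    rcases lt_trichotomy (toLex y) (toLex y') with hlt | heq | hlt
    · exact absurd (hord _ _ hlt) (by rw [h]; exact lt_irrefl _)
    · exact toLex_inj.1 heq
    · exact absurd (hord _ _ hlt) (by rw [h]; exact lt_irrefl _)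
  let e : Cantor ≃ Cantor := Equiv.ofBijective Φ ⟨hinj, fun w => ⟨Ψ w, hΦΨ w⟩⟩
  -- A continuous bijection of a compact Hausdorff space is a homeomorphism.
  have hcont : Continuous e := hrec.continuous
  refine ⟨hcont.homeoOfEquivCompactToT2, hrec, hord, fun σ => ?_⟩
  change μ (Φ ⁻¹' cyl σ) ≤ 2 ^ 1 * lebesgue (cyl σ)
  set m := binVal σ with hm
  set l := σ.length with hl
  have hml : m < 2 ^ l := by rw [hm, binVal_eq_initVal]; exact initVal_lt _ _
  -- A cylinder is the interval between two adjacent cuts, so its preimage is the interval between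
  -- the matched cuts, and `Steep` bounds its measure.
  have hset : Φ ⁻¹' cyl σ = {y | Above (pre (m, l)).1 y ∧ ¬ Above (pre (m + 1, l)).1 y} := by
    ext y
    simp only [Set.mem_preimage, mem_cyl_iff_initVal, Set.mem_ofPred_eq, ← hΦ]
    simp only [Above, ← hl, ← hm]
    omega
  have hv₁ : dval (pre (m, l)).2 = m / 2 ^ l := hpre_snd (m, l) (dval_lt_one_iff.2 hml)
  have hv₂ : dval (pre (m + 1, l)).2 = (m + 1) / 2 ^ l := by
    rw [hpre_val, min_eq_left]
    · simp [dval]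
    · rw [dval, div_le_one (by positivity)]
      exact_mod_cast hml
  have hsteep := (hfitS _ (hpre_mem (m, l)) _ (hpre_mem (m + 1, l))).steep_of_snd_lt (by
    rw [hv₁, hv₂]
    gcongr
    linarith)
  have hreal : μ.real (Φ ⁻¹' cyl σ) ≤ 2 * (1 / 2) ^ l := by
    rw [hset, measureReal_between μ hsteep.1.le]
    refine hsteep.2.2.le.trans (le_of_eq ?_)
    rw [hv₁, hv₂, div_pow, one_pow]
    ring
  rw [lebesgue_cyl, ← ENNReal.toReal_le_toReal (measure_ne_top _ _)
    (ENNReal.mul_ne_top (by simp) (by simp))]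
  simpa [Measure.real, ENNReal.toReal_mul, ENNReal.toReal_pow, ENNReal.toReal_inv] using hreal

end ContRand

/-! ### The equivalence -/

theorem mainTheorem4 (x z : ContRand.Cantor) :
    List.TFAE [
      ∃ (μ : Measure ContRand.Cantor) (p : ℕ → ContRand.Code),
        IsProbabilityMeasure μ ∧ ContRand.IsContinuous μ ∧
        ContRand.Represents p μ ∧ ComputableIn {ContRand.oracle z} p ∧
        ContRand.RandomRel μ p z x,
      ∃ (ν : Measure ContRand.Cantor) (p : ℕ → ContRand.Code),
        IsProbabilityMeasure ν ∧ ContRand.IsContinuous ν ∧ ContRand.IsDyadic ν ∧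
        ContRand.Represents p ν ∧ ComputableIn {ContRand.oracle z} p ∧
        ContRand.RandomRel ν p z x,
      ∃ Φ : ContRand.Cantor ≃ₜ ContRand.Cantor,
        ContRand.RecursiveFunctional z Φ ∧ ContRand.OrderPreserving Φ ∧
        ContRand.MLRandomRel z (Φ x),
      ∃ R : ContRand.Cantor,
        ContRand.MLRandomRel z R ∧ ContRand.TTEquivRel z x R ] := by
  tfae_have 1 → 3 := by
    rintro ⟨μ, p, hprob, hμ, hp, hpz, hx⟩
    obtain ⟨Φ, hrec, hord, hle⟩ := ContRand.exists_homeomorph hμ hp hpz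
    refine ⟨Φ, hrec, hord, ?_⟩
    have hΦx : ContRand.PassesTests {ContRand.oracle p, ContRand.oracle z} ContRand.lebesgue (Φ x) :=
      ContRand.PassesTests.map (by simp) hrec 1 hle hx
    -- Randomness was obtained relative to `p` and `z` together; the weaker oracle `z` is enough for
    -- (iii).
    exact hΦx.mono fun g hg => RecursiveIn.oracle g (Or.inr hg)
  tfae_have 3 → 4 := by
    rintro ⟨Φ, hrec, -, hx⟩
    exact ⟨Φ x, hx, ⟨Φ.symm, hrec.symm, by simp⟩, ⟨Φ, hrec, rfl⟩⟩
  tfae_have 4 → 2 := by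
    rintro ⟨R, hR, hxR⟩
    obtain ⟨Φ, hrec, hfib, rfl⟩ := hxR.exists_countable_fibres
    exact ContRand.exists_dyadic_of_recursiveFunctional hrec (fun w => (hfib w).measure_zero _) hR
  tfae_have 2 → 1 := by
    rintro ⟨ν, p, hprob, hν, -, hp, hpz, hx⟩
    exact ⟨ν, p, hprob, hν, hp, hpz, hx⟩
  tfae_finish
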